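/- Conventions. All sets are subsets of $\omega$. A Turing ideal is a nonempty collection $\mathcal I$ of sets closed downwards under $\leq_T$ and closed under $\oplus$; all ideals are countable and are presented by an exact pair, i.e. by sets $A_0,A_1$ such that $S\in\mathcal I$ if and only if $S\leq_T A_0$ and $S\leq_T A_1$. Write $\langle G\rangle$ for the principal ideal of all $G$-computable sets. A Mathias condition is a pair $(D,S)$ with $D$ finite, $S$ infinite and $\max D<\min S$; it is an $\mathcal I$-condition if $S\in\mathcal I$. A condition $(\widetilde D,\widetilde S)$ extends $(D,S)$ if $D\subseteq\widetilde D\subseteq D\cup S$ and $\widetilde S\subseteq S$; a set $A$ satisfies $(D,S)$ if $D\subseteq A\subseteq D\cup S$. An index of an $\mathcal I$-condition $(D,S)$ is a triple consisting of the canonical index of $D$ and of numbers $e_0,e_1$ with $\Phi_{e_0}^{A_0}=\Phi_{e_1}^{A_1}=S$. A collection of $\mathcal I$-conditions is $\Sigma^0_n(\mathcal I)$-definable if the set of indices of its members is $\Sigma^0_n(A_0\oplus A_1)$. A set $G$ is $n$-$\mathcal I$-generic if for every $\Sigma^0_n(\mathcal I)$-definable collection $\mathcal C$ of $\mathcal I$-conditions,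 $G$ either satisfies a condition in $\mathcal C$ or satisfies an $\mathcal I$-condition that has no extension in $\mathcal C$. Theorem. Let $\mathcal I$ be a (countable) Turing ideal, presented by any exact pair, and let $G$ be a $3$-$\mathcal I$-generic set. Then: (1) no $3$-$\langle G\rangle$-generic set contained in $G$ computes $G$, whichever exact pair is chosen to present $\langle G\rangle$ (for instance $(G,G)$); (2) for every infinite $G$-computable set $X\subseteq G$ and every $e\in\omega$ there is an infinite $G$-computable set $Y\subseteq X$ such that $\Phi_e^{Y}\neq G$. -/

import Mathlib

namespace MathiasForcing

open Classical in
/-- The characteristic function of a set of natural numbers. -/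
noncomputable def charFn (A : Set ℕ) (x : ℕ) : ℕ := if x ∈ A then 1 else 0

/-- Turing reducibility `A ≤_T B` of sets of natural numbers. -/
def SetReducible (A B : Set ℕ) : Prop :=
  TuringReducible (charFn A : ℕ →. ℕ) (charFn B : ℕ →. ℕ)

/-- The effective join `A ⊕ B = {2x : x ∈ A} ∪ {2x + 1 : x ∈ B}`. -/
def join (A B : Set ℕ) : Set ℕ :=
  {n | (∃ x ∈ A, n = 2 * x) ∨ ∃ x ∈ B, n = 2 * x + 1}

/-- The canonical index `∑_{i ∈ A, i < s} 2 ^ i` of the finite set `A ∩ {0, …, s - 1}`. -/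
noncomputable def restrict (A : Set ℕ) (s : ℕ) : ℕ :=
  ∑ i ∈ Finset.range s, charFn A i * 2 ^ i

/-- The `e`-th Turing functional `Φ_e^A`. The `e`-th program is run on inputs consisting of the
argument `x` and an initial segment of the oracle (given by its length `s` and the canonical index
of `A ∩ {0, …, s - 1}`). One searches for the first pair `⟨s, k⟩` such that the run with the
initial segment of length `s` halts within `k` steps, and returns its output. This is an
acceptable numbering of the Turing functionals. -/
noncomputable def functional (e : ℕ) (A : Set ℕ) : ℕ →. ℕ := fun x =>
  Nat.rfindOpt fun t =>
    Nat.Partrec.Code.evaln t.unpair.2 (Denumerable.ofNat Nat.Partrec.Code e)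
      (Nat.pair x (Nat.pair t.unpair.1 (restrict A t.unpair.1)))

/-- `Φ_e^A = B`: the function `Φ_e^A` is total and is the characteristic function of `B`. -/
def Computes (e : ℕ) (A B : Set ℕ) : Prop :=
  ∀ x, functional e A x = Part.some (charFn B x)

/-- A set of natural numbers is `Σ⁰_0(X)` if it is `X`-computable, and `Σ⁰_{n+1}(X)` if it is the
projection of a `Π⁰_n(X)` relation (one whose complement is `Σ⁰_n(X)`). -/
def IsSigma (X : Set ℕ) : ℕ → Set ℕ → Prop
  | 0, W => SetReducible W X
  | n + 1, W => ∃ V : Set ℕ, IsSigma X n Vᶜ ∧ ∀ x, x ∈ W ↔ ∃ y, Nat.pair x y ∈ V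

/-- A Turing ideal: a nonempty collection of sets closed downwards under `≤_T` and closed
under `⊕`. -/
structure IsTuringIdeal (I : Set (Set ℕ)) : Prop where
  nonempty : I.Nonempty
  mem_of_reducible : ∀ A B, B ∈ I → SetReducible A B → A ∈ I
  join_mem : ∀ A B, A ∈ I → B ∈ I → join A B ∈ I

/-- `(A₀, A₁)` is an exact pair for `I`. -/
def IsExactPair (A₀ A₁ : Set ℕ) (I : Set (Set ℕ)) : Prop :=
  ∀ S, S ∈ I ↔ SetReducible S A₀ ∧ SetReducible S A₁

/-- The principal ideal `⟨A⟩` of all `A`-computable sets. -/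
def principal (A : Set ℕ) : Set (Set ℕ) := {S | SetReducible S A}

/-- A Mathias condition `(D, S)`: `D` is finite, `S` is infinite, and `max D < min S`. -/
structure Condition where
  D : Finset ℕ
  S : Set ℕ
  infinite : S.Infinite
  lt : ∀ d ∈ D, ∀ s ∈ S, d < s

/-- `q` extends `p`. -/
def Extends (q p : Condition) : Prop :=
  (p.D : Set ℕ) ⊆ q.D ∧ (q.D : Set ℕ) ⊆ p.D ∪ p.S ∧ q.S ⊆ p.S

/-- The set `A` satisfies the condition `p`. -/
def Satisfies (A : Set ℕ) (p : Condition) : Prop :=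
  (p.D : Set ℕ) ⊆ A ∧ A ⊆ p.D ∪ p.S

/-- `A` meets `C`: it satisfies a condition in `C`. -/
def Meets (A : Set ℕ) (C : Set Condition) : Prop := ∃ p ∈ C, Satisfies A p

/-- `A` avoids `C` (in Mathias forcing over `I`): it satisfies an `I`-condition that has no
extension in `C`. -/
def Avoids (I : Set (Set ℕ)) (A : Set ℕ) (C : Set Condition) : Prop :=
  ∃ p : Condition, p.S ∈ I ∧ Satisfies A p ∧ ∀ q ∈ C, ¬ Extends q p

/-- `c = ⟨d, ⟨e₀, e₁⟩⟩` is an index of the condition `p = (D, S)` with respect to the exact pair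
`(A₀, A₁)`: `d = ∑_{i ∈ D} 2 ^ i` is the canonical index of `D`, and
`Φ_{e₀}^{A₀} = Φ_{e₁}^{A₁} = S`. -/
def IsIndex (A₀ A₁ : Set ℕ) (c : ℕ) (p : Condition) : Prop :=
  c.unpair.1 = ∑ i ∈ p.D, 2 ^ i ∧
    Computes c.unpair.2.unpair.1 A₀ p.S ∧ Computes c.unpair.2.unpair.2 A₁ p.S

/-- `C` is a `Σ⁰_n(I)`-definable collection of `I`-conditions, where `I` is presented by the exact
pair `(A₀, A₁)`: the set of all indices of members of `C` is `Σ⁰_n(A₀ ⊕ A₁)`. -/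
def IsDefinableCollection (n : ℕ) (I : Set (Set ℕ)) (A₀ A₁ : Set ℕ) (C : Set Condition) : Prop :=
  (∀ p ∈ C, p.S ∈ I) ∧ IsSigma (join A₀ A₁) n {c | ∃ p ∈ C, IsIndex A₀ A₁ c p}

/-- `G` is `n`-`I`-generic, where `I` is presented by the exact pair `(A₀, A₁)`. -/
def IsGeneric (n : ℕ) (I : Set (Set ℕ)) (A₀ A₁ : Set ℕ) (G : Set ℕ) : Prop :=
  ∀ C : Set Condition, IsDefinableCollection n I A₀ A₁ C → Meets G C ∨ Avoids I G C

end MathiasForcing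

open MathiasForcing

/-! Both claims reduce to `IsGeneric.not_uniformly_computable`: if `X ⊆ G` is infinite and
`G`-computable, no primitive recursive relation `P` lets the finite subsets of `X` give only correct
answers about `G` while every infinite `G`-computable `Y ⊆ X` has finite subsets answering every
question.

Let `X = Φ_i^G`. A condition may force `Φ_i^G` to be bounded, or to leave `G`, or to contain a
finite set giving a wrong answer, or it may have a reservoir whose finite subsets give no answer at
some argument. If `G` satisfies such a condition, one of the assumptions on `X` and `P` fails. These
clauses are Σ₂ in the reservoir and being an index is Π₂, so the collection is Σ₃, and
`3`-genericity applies once it is dense (`exists_extension`).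

For density, suppose `(D, S)` has no extension of these kinds. Choose `x ∈ S` and start from `D ∪
{x}` and `D`, which disagree at `x`. `exists_split_set` end-extends both inside `S`, `S`-computably
and never deciding `x` again, so that the two values of `Φ_i` acquire common elements forming an
infinite `Y ⊆ S`. Some finite `F ⊆ Y` gives an answer at `x`. Both sides eventually put `F` into
`Φ_i`, yet one side contains `x` and the other does not, so the answer is wrong on one of them: an
error is forced after all.

For (2), if `Φ_e^Y = G` for all such `Y`, take `P` to be convergence of `Φ_e` on finite oracles. For
(1), if `Φ_e^H = G`, then `H` satisfies a condition `(D, S)` with `S ≤_T G` and no extension forcing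
a wrong value or divergence. Then `G ∩ S` is infinite, and `P` can be convergence of `Φ_e` on `D ∪
F`. -/

namespace MathiasForcing

-- Closure properties of primitive recursion, arranged for automation.

attribute [fun_prop] Primrec PrimrecPred
attribute [fun_prop] Primrec.id Primrec.const Primrec.comp PrimrecPred.comp

section Primrec
variable {α β γ : Type*} [Primcodable α] [Primcodable β] [Primcodable γ]

@[fun_prop] theorem primrec_fst {f : α → β × γ} (hf : Primrec f) : Primrec fun a => (f a).1 :=
  Primrec.fst.comp hf

@[fun_prop] theorem primrec_snd {f : α → β × γ} (hf : Primrec f) : Primrec fun a => (f a).2 :=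
  Primrec.snd.comp hf

@[fun_prop] theorem primrec_mk {f : α → β} {g : α → γ} (hf : Primrec f) (hg : Primrec g) :
    Primrec fun a => (f a, g a) := hf.pair hg

@[fun_prop] theorem primrec_add {f g : α → ℕ} (hf : Primrec f) (hg : Primrec g) :
    Primrec fun a => f a + g a := Primrec.nat_add.comp hf hg

@[fun_prop] theorem primrec_mod {f g : α → ℕ} (hf : Primrec f) (hg : Primrec g) :
    Primrec fun a => f a % g a := Primrec.nat_mod.comp hf hg

@[fun_prop] theorem primrec_div {f g : α → ℕ} (hf : Primrec f) (hg : Primrec g) :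
    Primrec fun a => f a / g a := Primrec.nat_div.comp hf hg

@[fun_prop] theorem primrec_mul {f g : α → ℕ} (hf : Primrec f) (hg : Primrec g) :
    Primrec fun a => f a * g a := Primrec.nat_mul.comp hf hg

@[fun_prop] theorem primrec_unpair {f : α → ℕ} (hf : Primrec f) :
    Primrec fun a => (f a).unpair := Primrec.unpair.comp hf

@[fun_prop] theorem primrec_natPair {f g : α → ℕ} (hf : Primrec f) (hg : Primrec g) :
    Primrec fun a => Nat.pair (f a) (g a) := Primrec₂.natPair.comp hf hg

@[fun_prop] theorem primrec_two_pow {f : α → ℕ} (hf : Primrec f) :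
    Primrec fun a => 2 ^ f a := by
  have h : Primrec fun n : ℕ => 2 ^ n := by
    refine (Primrec.nat_rec₁ (f := fun _ b => b * 2) 1 ?_).of_eq fun n => ?_
    · exact Primrec.nat_mul.comp Primrec.snd (Primrec.const 2)
    · induction n with
      | zero => rfl
      | succ n ih => simp only [pow_succ, ← ih]
  exact h.comp hf

@[fun_prop] theorem primrecPred_lt {f g : α → ℕ} (hf : Primrec f) (hg : Primrec g) :
    PrimrecPred fun a => f a < g a := Primrec.nat_lt.comp hf hg

@[fun_prop] theorem primrecPred_le {f g : α → ℕ} (hf : Primrec f) (hg : Primrec g) :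
    PrimrecPred fun a => f a ≤ g a := Primrec.nat_le.comp hf hg

@[fun_prop] theorem primrecPred_eq {f g : α → β} (hf : Primrec f) (hg : Primrec g) :
    PrimrecPred fun a => f a = g a := Primrec.eq.comp hf hg

@[fun_prop] theorem primrecPred_and {p q : α → Prop} (hp : PrimrecPred p) (hq : PrimrecPred q) :
    PrimrecPred fun a => p a ∧ q a := hp.and hq

@[fun_prop] theorem primrecPred_or {p q : α → Prop} (hp : PrimrecPred p) (hq : PrimrecPred q) :
    PrimrecPred fun a => p a ∨ q a := hp.or hq

@[fun_prop] theorem primrecPred_not {p : α → Prop} (hp : PrimrecPred p) :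
    PrimrecPred fun a => ¬ p a := hp.not

@[fun_prop] theorem primrecPred_imp {p q : α → Prop} (hp : PrimrecPred p) (hq : PrimrecPred q) :
    PrimrecPred fun a => p a → q a := (hp.not.or hq).of_eq fun _ => by tauto

@[fun_prop] theorem primrecPred_forall_lt {n : α → ℕ} {p : α → ℕ → Prop} (hn : Primrec n)
    (hp : PrimrecPred fun q : α × ℕ => p q.1 q.2) :
    PrimrecPred fun a => ∀ j < n a, p a j := by
  have h : PrimrecRel fun (j : ℕ) (a : α) => p a j := hp.comp (Primrec.snd.pair Primrec.fst)
  exact ((PrimrecRel.forall_mem_list h).comp (Primrec.list_range.comp hn) Primrec.id).of_eq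
    fun a => by simp

@[fun_prop] theorem primrecPred_exists_lt {n : α → ℕ} {p : α → ℕ → Prop} (hn : Primrec n)
    (hp : PrimrecPred fun q : α × ℕ => p q.1 q.2) :
    PrimrecPred fun a => ∃ j < n a, p a j := by
  have h : PrimrecRel fun (j : ℕ) (a : α) => p a j := hp.comp (Primrec.snd.pair Primrec.fst)
  exact ((PrimrecRel.exists_mem_list h).comp (Primrec.list_range.comp hn) Primrec.id).of_eq
    fun a => by simp

end Primrec

/-! ### Canonical indices of finite sets and initial segments. -/

section Bits
variable {α : Type*} [Primcodable α]

/-- The finite set with canonical index `a`. -/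
def bits (a : ℕ) : Set ℕ := {i | a.testBit i = true}

theorem mem_bits {a i : ℕ} : i ∈ bits a ↔ a.testBit i = true := Iff.rfl

theorem bits_injective : Function.Injective bits := fun a b h => by
  refine Nat.eq_of_testBit_eq fun i => Bool.eq_iff_iff.2 ?_
  exact Set.ext_iff.1 h i

theorem lt_of_mem_bits {a i : ℕ} (h : i ∈ bits a) : i < a :=
  lt_of_lt_of_le Nat.lt_two_pow_self (Nat.ge_two_pow_of_testBit h)

theorem lt_of_mem_bits_of_lt {a i u : ℕ} (h : i ∈ bits a) (ha : a < 2 ^ u) : i < u := by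
  by_contra hi
  have h1 : 2 ^ i ≤ a := Nat.ge_two_pow_of_testBit h
  exact absurd (h1.trans_lt ha) (not_lt.2 (Nat.pow_le_pow_right (by norm_num) (not_lt.1 hi)))

theorem mem_bits_mod {a i u : ℕ} : i ∈ bits (a % 2 ^ u) ↔ i < u ∧ i ∈ bits a := by
  simp [mem_bits, Nat.testBit_mod_two_pow]

theorem finite_bits (a : ℕ) : (bits a).Finite :=
  (Set.finite_lt_nat a).subset fun _ h => lt_of_mem_bits h

@[fun_prop] theorem primrecPred_mem_bits {f g : α → ℕ} (hf : Primrec f) (hg : Primrec g) :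
    PrimrecPred fun a => f a ∈ bits (g a) := by
  have h : PrimrecPred fun a => g a / 2 ^ f a % 2 = 1 := by fun_prop
  exact h.of_eq fun a => by simp [mem_bits, Nat.testBit_eq_decide_div_mod_eq]

theorem charFn_of_mem {A : Set ℕ} {x : ℕ} (h : x ∈ A) : charFn A x = 1 := by simp [charFn, h]

theorem charFn_of_notMem {A : Set ℕ} {x : ℕ} (h : x ∉ A) : charFn A x = 0 := by simp [charFn, h]

theorem charFn_eq_one {A : Set ℕ} {x : ℕ} : charFn A x = 1 ↔ x ∈ A := by
  simp [charFn]

theorem charFn_congr {A B : Set ℕ} {x y : ℕ} (h : x ∈ A ↔ y ∈ B) : charFn A x = charFn B y := by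
  by_cases hy : y ∈ B
  · rw [charFn_of_mem hy, charFn_of_mem (h.2 hy)]
  · rw [charFn_of_notMem hy, charFn_of_notMem (mt h.1 hy)]

@[fun_prop] theorem primrec_charFn_bits {f g : α → ℕ} (hf : Primrec f) (hg : Primrec g) :
    Primrec fun a => charFn (bits (g a)) (f a) := by
  classical
  exact (Primrec.ite (primrecPred_mem_bits hf hg) (Primrec.const 1) (Primrec.const 0)).of_eq
    fun a => by simp [charFn]

theorem restrict_succ (A : Set ℕ) (s : ℕ) :
    restrict A (s + 1) = restrict A s + charFn A s * 2 ^ s := Finset.sum_range_succ _ _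

theorem restrict_lt (A : Set ℕ) (s : ℕ) : restrict A s < 2 ^ s := by
  induction s with
  | zero => simp [restrict]
  | succ s ih =>
    have : charFn A s ≤ 1 := by unfold charFn; split_ifs <;> simp
    rw [restrict_succ, pow_succ]
    nlinarith

theorem mem_bits_restrict {A : Set ℕ} {s i : ℕ} : i ∈ bits (restrict A s) ↔ i < s ∧ i ∈ A := by
  induction s with
  | zero => simp [restrict, mem_bits]
  | succ s ih =>
    have hlt := restrict_lt A s
    rw [mem_bits] at ih ⊢
    rw [restrict_succ]
    by_cases hs : s ∈ A
    · rw [charFn_of_mem hs, one_mul, add_comm]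
      rcases lt_trichotomy i s with h | h | h
      · rw [Nat.testBit_two_pow_add_gt h, ih]
        simp [h, h.trans (Nat.lt_succ_self s)]
      · subst h
        rw [Nat.testBit_two_pow_add_eq, Nat.testBit_lt_two_pow hlt]
        simp [hs]
      · rw [Nat.testBit_lt_two_pow]
        · simp; intro; omega
        · calc 2 ^ s + restrict A s < 2 ^ s + 2 ^ s := by omega
            _ = 2 ^ (s + 1) := by ring
            _ ≤ 2 ^ i := Nat.pow_le_pow_right (by norm_num) h
    · rw [charFn_of_notMem hs, zero_mul, add_zero, ih]
      constructor
      · rintro ⟨h1, h2⟩; exact ⟨by omega, h2⟩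
      · rintro ⟨h1, h2⟩
        refine ⟨lt_of_le_of_ne (by omega) ?_, h2⟩
        rintro rfl; exact hs h2

theorem eq_restrict {A : Set ℕ} {s a : ℕ} (h : ∀ i, i ∈ bits a ↔ i < s ∧ i ∈ A) :
    a = restrict A s :=
  bits_injective (Set.ext fun i => (h i).trans mem_bits_restrict.symm)

theorem restrict_congr {A B : Set ℕ} {s : ℕ} (h : ∀ i < s, i ∈ A ↔ i ∈ B) :
    restrict A s = restrict B s :=
  eq_restrict fun i => mem_bits_restrict.trans (and_congr_right (h i))

theorem restrict_bits (a s : ℕ) : restrict (bits a) s = a % 2 ^ s :=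
  (eq_restrict fun _ => mem_bits_mod).symm

theorem bits_sum_two_pow (D : Finset ℕ) : bits (∑ i ∈ D, 2 ^ i) = D := by
  ext i
  rw [mem_bits, ← Nat.mem_bitIndices, ← List.mem_toFinset, Finset.toFinset_bitIndices_sum_two_pow]
  rfl

theorem exists_bits_eq {A : Set ℕ} (h : A.Finite) : ∃ a, bits a = A :=
  ⟨∑ i ∈ h.toFinset, 2 ^ i, by rw [bits_sum_two_pow]; simp⟩

/-- The finite set with canonical index `a`, as a `Finset`. -/
noncomputable def bitFinset (a : ℕ) : Finset ℕ := (finite_bits a).toFinset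

@[simp] theorem coe_bitFinset (a : ℕ) : (bitFinset a : Set ℕ) = bits a := by simp [bitFinset]

theorem mem_bitFinset {a i : ℕ} : i ∈ bitFinset a ↔ i ∈ bits a := by simp [bitFinset]

theorem sum_bitFinset (a : ℕ) : ∑ i ∈ bitFinset a, 2 ^ i = a :=
  bits_injective (by rw [bits_sum_two_pow, coe_bitFinset])

end Bits

/-! ### Bounded convergence and the use principle. -/

section Convergence

/-- `Φ_e^A(x)` converges to `v`, the computation being found among the first `T` pairs
`⟨s, k⟩`. -/
def Conv (e : ℕ) (A : Set ℕ) (x v T : ℕ) : Prop :=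
  ∃ t < T, Nat.Partrec.Code.evaln t.unpair.2 (Denumerable.ofNat Nat.Partrec.Code e)
      (Nat.pair x (Nat.pair t.unpair.1 (restrict A t.unpair.1))) = some v ∧
    ∀ t' < t, Nat.Partrec.Code.evaln t'.unpair.2 (Denumerable.ofNat Nat.Partrec.Code e)
      (Nat.pair x (Nat.pair t'.unpair.1 (restrict A t'.unpair.1))) = none

theorem Conv.mono {e : ℕ} {A : Set ℕ} {x v T T' : ℕ} (h : Conv e A x v T) (hT : T ≤ T') :
    Conv e A x v T' := by
  obtain ⟨t, ht, h⟩ := h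
  exact ⟨t, ht.trans_le hT, h⟩

/-- The bound `T` also bounds the use: each pair `⟨s, k⟩` inspected is below `T`, and `s` is at most
the code of the pair. -/
theorem Conv.congr {e : ℕ} {A B : Set ℕ} {x v T : ℕ} (h : Conv e A x v T)
    (hAB : ∀ i < T, i ∈ A ↔ i ∈ B) : Conv e B x v T := by
  obtain ⟨t, ht, h1, h2⟩ := h
  have key : ∀ t' ≤ t, restrict B t'.unpair.1 = restrict A t'.unpair.1 := fun t' ht' =>
    restrict_congr fun i hi => (hAB i (by have := Nat.unpair_left_le t'; omega)).symm
  refine ⟨t, ht, by rw [key t le_rfl, h1], fun t' ht' => ?_⟩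
  rw [key t' ht'.le, h2 t' ht']

theorem mem_functional_iff {e : ℕ} {A : Set ℕ} {x v : ℕ} :
    v ∈ functional e A x ↔ ∃ T, Conv e A x v T := by
  unfold functional Conv
  constructor
  · intro h
    obtain ⟨t, ht, hv⟩ := Part.mem_bind_iff.1 h
    refine ⟨t + 1, t, by omega, Part.mem_coe.1 hv, fun t' ht' => ?_⟩
    simpa using Nat.rfind_min ht ht'
  · rintro ⟨T, t, -, h1, h2⟩
    refine Part.mem_bind_iff.2 ⟨t, Nat.mem_rfind.2 ⟨?_, fun {t'} ht' => ?_⟩, Part.mem_coe.2 h1⟩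
    · simp [h1]
    · simp [h2 t' ht']

theorem Conv.unique {e : ℕ} {A : Set ℕ} {x v w T T' : ℕ} (h : Conv e A x v T)
    (h' : Conv e A x w T') : v = w :=
  Part.mem_unique (mem_functional_iff.2 ⟨T, h⟩) (mem_functional_iff.2 ⟨T', h'⟩)

theorem computes_iff {e : ℕ} {A B : Set ℕ} :
    Computes e A B ↔ ∀ x, ∃ T, Conv e A x (charFn B x) T := by
  simp only [Computes, Part.eq_some_iff, mem_functional_iff]

theorem Computes.conv {e : ℕ} {A B : Set ℕ} (h : Computes e A B) (x : ℕ) :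
    ∃ T, Conv e A x (charFn B x) T := computes_iff.1 h x

theorem Computes.eq_charFn {e : ℕ} {A B : Set ℕ} (h : Computes e A B) {x v T : ℕ}
    (hv : Conv e A x v T) : v = charFn B x := by
  obtain ⟨T', hT'⟩ := h.conv x
  exact hv.unique hT'

variable {α : Type*} [Primcodable α]

@[fun_prop] theorem primrecPred_conv {e a x v T : α → ℕ} (he : Primrec e) (ha : Primrec a)
    (hx : Primrec x) (hv : Primrec v) (hT : Primrec T) :
    PrimrecPred fun q => Conv (e q) (bits (a q)) (x q) (v q) (T q) := by
  have key : ∀ {β : Type _} [Primcodable β] {e a x t : β → ℕ}, Primrec e → Primrec a → Primrec x →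
      Primrec t → Primrec fun q => Nat.Partrec.Code.evaln (t q).unpair.2
        (Denumerable.ofNat Nat.Partrec.Code (e q))
        (Nat.pair (x q) (Nat.pair (t q).unpair.1 (a q % 2 ^ (t q).unpair.1))) := by
    intro β _ e a x t he ha hx ht
    refine Nat.Partrec.Code.primrec_evaln.comp (Primrec.pair (Primrec.pair ?_ ?_) ?_)
    · fun_prop
    · exact (Primrec.ofNat _).comp he
    · refine primrec_natPair hx (primrec_natPair ?_ ?_)
      · fun_prop
      · refine primrec_mod ha ?_
        fun_prop
  simp only [Conv, restrict_bits]
  refine primrecPred_exists_lt hT (primrecPred_and ?_ ?_)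
  · refine primrecPred_eq (key ?_ ?_ ?_ ?_) (Primrec.option_some.comp ?_) <;> fun_prop
  · refine primrecPred_forall_lt (by fun_prop) ?_
    refine primrecPred_eq (key ?_ ?_ ?_ ?_) (Primrec.const _) <;> fun_prop

end Convergence

/-! ### Computability from an oracle: search, iteration and ranges. -/

/-- The total function `f` is computable from the oracle `A`. -/
def RecIn (A : Set ℕ) (f : ℕ → ℕ) : Prop :=
  Nat.RecursiveIn {((charFn A : ℕ → ℕ) : ℕ →. ℕ)} (f : ℕ →. ℕ)

theorem setReducible_iff {A B : Set ℕ} : SetReducible B A ↔ RecIn A (charFn B) :=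
  RecursiveIn.iff_nat

namespace RecIn
variable {A B : Set ℕ} {f g : ℕ → ℕ}

protected theorem of_eq (hf : RecIn A f) (h : ∀ n, f n = g n) : RecIn A g :=
  (funext h : f = g) ▸ hf

theorem of_primrec (hf : Primrec f) : RecIn A f := (Primrec.nat_iff.1 hf).recursiveIn

protected theorem charFn : RecIn A (charFn A) := Nat.RecursiveIn.oracle _ rfl

protected theorem comp (hf : RecIn A f) (hg : RecIn A g) : RecIn A fun n => f (g n) :=
  (Nat.RecursiveIn.comp hf hg).of_eq_tot fun _ => Part.mem_bind (Part.mem_some _) (Part.mem_some _)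

protected theorem pair (hf : RecIn A f) (hg : RecIn A g) :
    RecIn A fun n => Nat.pair (f n) (g n) :=
  (Nat.RecursiveIn.pair hf hg).of_eq_tot fun n => by simp [Seq.seq]

theorem rec (a : ℕ) (hg : RecIn A g) :
    RecIn A fun n => Nat.rec a (fun y ih => g (Nat.pair y ih)) n := by
  have h0 : RecIn A fun _ => a := of_primrec (Primrec.const a)
  have h1 : RecIn A fun n => g n.unpair.2 :=
    hg.comp (of_primrec (Primrec.snd.comp Primrec.unpair))
  have h2 : RecIn A fun n => Nat.pair 0 n := of_primrec (by fun_prop)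
  refine (Nat.RecursiveIn.comp (Nat.RecursiveIn.prec h0 h1) h2).of_eq_tot fun n => ?_
  simp only [PFun.coe_val, Part.bind_eq_bind, Part.bind_some, Nat.unpair_pair]
  induction n with
  | zero => simp
  | succ n ih => exact Part.mem_bind ih (by simp)

theorem trans (hf : RecIn B f) (h : SetReducible B A) : RecIn A f := by
  refine Nat.RecursiveIn.subst hf fun g hg => ?_
  rw [Set.mem_singleton_iff.1 hg]
  exact setReducible_iff.1 h

theorem of_primrec_comp (hf : Primrec f) (hg : RecIn A g) : RecIn A fun n => f (g n) :=
  (of_primrec hf).comp hg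

protected theorem restrict : RecIn A (restrict A) := by
  have h : RecIn A fun n => n.unpair.2 + charFn A n.unpair.1 * 2 ^ n.unpair.1 := by
    have h1 : RecIn A fun n => Nat.pair n (charFn A n.unpair.1) :=
      (of_primrec Primrec.id).pair (RecIn.charFn.comp (of_primrec (by fun_prop)))
    refine (of_primrec_comp (f := fun m => m.unpair.1.unpair.2 +
      m.unpair.2 * 2 ^ m.unpair.1.unpair.1) (by fun_prop) h1).of_eq fun n => by simp
  refine (RecIn.rec 0 h).of_eq fun n => ?_
  induction n with
  | zero => rfl
  | succ n ih =>
    rw [restrict_succ]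
    simp only [Nat.unpair_pair] at ih ⊢
    rw [ih]

theorem restrict_of_reducible (h : SetReducible B A) : RecIn A (restrict B) :=
  RecIn.restrict.trans h

/-- A predicate that is primitive recursive in a computable function is computable. -/
theorem of_primrecPred {τ : ℕ → ℕ} (hτ : RecIn A τ) {Q : ℕ → ℕ → Prop}
    (hQ : PrimrecPred fun q : ℕ × ℕ => Q q.1 q.2) : RecIn A (charFn {n | Q n (τ n)}) := by
  classical
  have h : Primrec fun m : ℕ => if Q m.unpair.1 m.unpair.2 then 1 else 0 := by
    have : PrimrecPred fun m : ℕ => Q m.unpair.1 m.unpair.2 := hQ.comp Primrec.unpair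
    exact Primrec.ite this (Primrec.const _) (Primrec.const _)
  refine (of_primrec_comp h ((of_primrec Primrec.id).pair hτ)).of_eq fun n => ?_
  simp [charFn]

theorem reducible_of_primrecPred {τ : ℕ → ℕ} (hτ : RecIn A τ) {Q : ℕ → ℕ → Prop}
    (hQ : PrimrecPred fun q : ℕ × ℕ => Q q.1 q.2) : SetReducible {n | Q n (τ n)} A :=
  setReducible_iff.2 (of_primrecPred hτ hQ)

/-- Unbounded search for a witness of a computable predicate. -/
theorem rfind {P : Set ℕ} (hP : SetReducible P A) :
    Nat.RecursiveIn {((charFn A : ℕ → ℕ) : ℕ →. ℕ)} fun a =>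
      Nat.rfind fun n => Part.some (charFn P (Nat.pair a n) = 1 : Bool) := by
  have h1 : RecIn A fun n => 1 - charFn P n :=
    of_primrec_comp (f := fun m => 1 - m) (Primrec.nat_sub.comp (Primrec.const 1) Primrec.id)
      (setReducible_iff.1 hP)
  refine (Nat.RecursiveIn.rfind h1).of_eq fun a => ?_
  congr 1
  funext n
  by_cases h : Nat.pair a n ∈ P
  · simp [charFn_of_mem h]
  · simp [charFn_of_notMem h]

theorem exists_search {P : Set ℕ} (hP : SetReducible P A) (h : ∀ x, ∃ n, Nat.pair x n ∈ P) :
    ∃ f, RecIn A f ∧ ∀ x, Nat.pair x (f x) ∈ P := by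
  classical
  refine ⟨fun x => Nat.find (h x), (rfind hP).of_eq_tot fun x => ?_, fun x => Nat.find_spec (h x)⟩
  refine Nat.mem_rfind.2 ⟨?_, fun {m} hm => ?_⟩
  · simpa [charFn_eq_one] using Nat.find_spec (h x)
  · simpa [charFn_eq_one] using Nat.find_min (h x) hm

/-- Iterated search: if every good number has a computably recognizable good successor, then
there is a computable sequence of successive good numbers. -/
theorem exists_seq {P : Set ℕ} (hP : SetReducible P A) (good : ℕ → Prop) (a₀ : ℕ)
    (h₀ : good a₀) (step : ∀ a, good a → ∃ n, Nat.pair a n ∈ P)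
    (hstep : ∀ a n, good a → Nat.pair a n ∈ P → good n.unpair.1) :
    ∃ f, RecIn A f ∧ f 0 = a₀ ∧ ∀ k, good (f k) ∧
      ∃ t, Nat.pair (f k) (Nat.pair (f (k + 1)) t) ∈ P := by
  classical
  -- The value `0` is only a filler: `next` is applied to good numbers alone, where the search
  -- succeeds.
  let next : ℕ → ℕ := fun a => if h : ∃ n, Nat.pair a n ∈ P then (Nat.find h).unpair.1 else 0
  let f : ℕ → ℕ := fun k => Nat.rec a₀ (fun _ ih => next ih) k
  have hgood : ∀ k, good (f k) := by
    intro k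
    induction k with
    | zero => exact h₀
    | succ k ih =>
      have h := step _ ih
      have : f (k + 1) = (Nat.find h).unpair.1 := dif_pos h
      rw [this]
      exact hstep _ _ ih (Nat.find_spec h)
  refine ⟨f, ?_, rfl, fun k => ⟨hgood k, ?_⟩⟩
  · have h0 : RecIn A fun _ => a₀ := of_primrec (Primrec.const a₀)
    have h1 := Nat.RecursiveIn.comp
      (of_primrec (A := A) (Primrec.fst.comp Primrec.unpair)) (Nat.RecursiveIn.comp (rfind hP)
        (of_primrec (A := A) (f := fun n => n.unpair.2.unpair.2) (by fun_prop)))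
    have h2 : RecIn A fun n => Nat.pair 0 n := of_primrec (by fun_prop)
    refine (Nat.RecursiveIn.comp (Nat.RecursiveIn.prec h0 h1) h2).of_eq_tot fun n => ?_
    simp only [PFun.coe_val, Part.bind_eq_bind, Part.bind_some, Nat.unpair_pair]
    induction n with
    | zero => exact Part.mem_some _
    | succ n ih =>
      have h := step _ (hgood n)
      have hf : f (n + 1) = (Nat.find h).unpair.1 := dif_pos h
      refine Part.mem_bind ih ?_
      rw [hf]
      refine Part.mem_bind (a := Nat.find h) ?_ (Part.mem_some _)
      refine Nat.mem_rfind.2 ⟨?_, fun {m} hm => ?_⟩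
      · simpa [charFn_eq_one] using Nat.find_spec h
      · simpa [charFn_eq_one] using Nat.find_min h hm
  · have h := step _ (hgood k)
    have hf : f (k + 1) = (Nat.find h).unpair.1 := dif_pos h
    refine ⟨(Nat.find h).unpair.2, ?_⟩
    rw [hf, Nat.pair_unpair]
    exact Nat.find_spec h

/-- The range of a computable strictly increasing function is computable. -/
theorem reducible_range (hf : RecIn A f) (hmono : StrictMono f) :
    SetReducible (Set.range f) A := by
  -- The least `k` with `x ≤ f k` is recognised from `f k` and `f (k - 1)`; then `x` is in the range
  -- iff `f k = x`. The case `k = 0` is exempted, so truncated subtraction does no harm.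
  have hτ : RecIn A fun n => Nat.pair (f n.unpair.2) (f (n.unpair.2 - 1)) :=
    (hf.comp (of_primrec (f := fun n => n.unpair.2) (by fun_prop))).pair
      (hf.comp (of_primrec (f := fun n => n.unpair.2 - 1)
        (Primrec.nat_sub.comp (by fun_prop) (by fun_prop))))
  have hP := reducible_of_primrecPred hτ
    (Q := fun n m => (n.unpair.2 = 0 ∨ m.unpair.2 < n.unpair.1) ∧ n.unpair.1 ≤ m.unpair.1)
    (by fun_prop)
  obtain ⟨g, hg, hgf⟩ := exists_search hP fun x => by
    have h : ∃ k, x ≤ f k := ⟨x, hmono.le_apply⟩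
    refine ⟨Nat.find h, ?_⟩
    simp only [Set.mem_ofPred_eq, Nat.unpair_pair]
    refine ⟨or_iff_not_imp_left.2 fun h0 => ?_, Nat.find_spec h⟩
    exact not_le.1 (Nat.find_min h (Nat.sub_lt (Nat.pos_of_ne_zero h0) one_pos))
  refine setReducible_iff.2 ((of_primrecPred (hf.comp hg) (Q := fun n m => n = m)
    (by fun_prop)).of_eq fun n => charFn_congr ?_)
  have h := hgf n
  simp only [Set.mem_ofPred_eq, Nat.unpair_pair] at h ⊢
  refine ⟨fun hn => ⟨g n, hn.symm⟩, ?_⟩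
  rintro ⟨k, rfl⟩
  have h1 : g (f k) ≤ k := by
    rcases h.1 with h0 | h0
    · omega
    · have := hmono.lt_iff_lt.1 h0
      omega
  exact le_antisymm h.2 (hmono.monotone h1)

end RecIn

/-! ### The numbering `functional` captures Turing reducibility. -/

section Use

theorem conv_bits_restrict {e : ℕ} {A : Set ℕ} {x v T N : ℕ} (h : T ≤ N) :
    Conv e (bits (restrict A N)) x v T ↔ Conv e A x v T := by
  have key : ∀ i < T, i ∈ bits (restrict A N) ↔ i ∈ A := fun i hi =>
    mem_bits_restrict.trans (and_iff_right (hi.trans_le h))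
  exact ⟨fun h => h.congr key, fun h => h.congr fun i hi => (key i hi).symm⟩

theorem Computes.reducible {e : ℕ} {A B : Set ℕ} (h : Computes e A B) : SetReducible B A := by
  have hP := RecIn.reducible_of_primrecPred (RecIn.restrict (A := A))
    (Q := fun n m => Conv e (bits m) n.unpair.1 n.unpair.2.unpair.1 n.unpair.2.unpair.2)
    (by fun_prop)
  have key : ∀ n : ℕ, n.unpair.2.unpair.2 ≤ n := fun n =>
    (Nat.unpair_right_le _).trans (Nat.unpair_right_le _)
  obtain ⟨f, hf, hfP⟩ := RecIn.exists_search hP fun x => by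
    obtain ⟨T, hT⟩ := h.conv x
    refine ⟨Nat.pair (charFn B x) T, ?_⟩
    rw [Set.mem_ofPred_eq, conv_bits_restrict (key _)]
    simpa using hT
  refine setReducible_iff.2 ((RecIn.of_primrec_comp (f := fun m => m.unpair.1)
    (by fun_prop) hf).of_eq fun x => ?_)
  have := hfP x
  rw [Set.mem_ofPred_eq, conv_bits_restrict (key _)] at this
  simpa using h.eq_charFn this

/-- Every function computable from `A` is approximated by a primitive recursive function of longer
and longer initial segments of `A`. -/
theorem exists_use {A : Set ℕ} {f : ℕ →. ℕ}
    (hf : Nat.RecursiveIn {((charFn A : ℕ → ℕ) : ℕ →. ℕ)} f) :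
    ∃ g : ℕ × ℕ × ℕ → Option ℕ, Primrec g ∧
      (∀ x v, v ∈ f x ↔ ∃ s, g (x, s, restrict A s) = some v) ∧
      ∀ x v s t, s ≤ t → g (x, s, restrict A s) = some v → g (x, t, restrict A t) = some v := by
  classical
  induction hf with
  | zero =>
    exact ⟨fun _ => some 0, Primrec.const _, fun x v =>
      ⟨fun h => ⟨0, congrArg some (Part.mem_some_iff.1 h).symm⟩,
        fun ⟨_, h⟩ => Part.mem_some_iff.2 (Option.some.inj h).symm⟩, by simp⟩
  | succ =>
    exact ⟨fun q => some (q.1 + 1), Primrec.option_some.comp (by fun_prop),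
      fun x v => by simp [eq_comm], by simp⟩
  | left =>
    exact ⟨fun q => some q.1.unpair.1, Primrec.option_some.comp (by fun_prop),
      fun x v => by simp [eq_comm], by simp⟩
  | right =>
    exact ⟨fun q => some q.1.unpair.2, Primrec.option_some.comp (by fun_prop),
      fun x v => by simp [eq_comm], by simp⟩
  | oracle g hg =>
    rw [Set.mem_singleton_iff.1 hg]
    refine ⟨fun q => if q.1 < q.2.1 then some (charFn (bits q.2.2) q.1) else none,
      Primrec.ite (by fun_prop) (Primrec.option_some.comp (by fun_prop)) (Primrec.const _), ?_, ?_⟩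
    · intro x v
      have key : ∀ s, x < s → charFn (bits (restrict A s)) x = charFn A x := fun s hs =>
        charFn_congr (by simp [mem_bits_restrict, hs])
      constructor
      · intro h
        refine ⟨x + 1, ?_⟩
        simp only [Nat.lt_succ_self x, if_true, key]
        exact congrArg some (Part.mem_some_iff.1 h).symm
      · rintro ⟨s, hs⟩
        by_cases h : x < s
        · simp only [h, if_true, key _ h, Option.some.injEq] at hs
          exact Part.mem_some_iff.2 hs.symm
        · simp [h] at hs
    · intro x v s t hst hs
      by_cases h : x < s
      · have h' := h.trans_le hst
        simp only [h, h', if_true, ← hs, Option.some.injEq]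
        exact charFn_congr (by simp [mem_bits_restrict, h, h'])
      · simp [h] at hs
  | @pair f h _ _ ihf ihh =>
    obtain ⟨g₁, hg₁, h₁, m₁⟩ := ihf
    obtain ⟨g₂, hg₂, h₂, m₂⟩ := ihh
    refine ⟨fun q => (g₁ q).bind fun a => (g₂ q).map fun b => Nat.pair a b, ?_, ?_, ?_⟩
    · refine Primrec.option_bind hg₁ (Primrec.option_map (hg₂.comp Primrec.fst) ?_)
      exact primrec_natPair (by fun_prop) (by fun_prop)
    · intro x v
      simp only [Seq.seq, Part.map_eq_map, Part.mem_bind_iff, Part.mem_map_iff, h₁, h₂,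
        Option.bind_eq_some_iff, Option.map_eq_some_iff]
      constructor
      · rintro ⟨F, ⟨a, ⟨s, hs⟩, rfl⟩, b, ⟨t, ht⟩, rfl⟩
        exact ⟨max s t, a, m₁ _ _ _ _ (le_max_left _ _) hs, b,
          m₂ _ _ _ _ (le_max_right _ _) ht, rfl⟩
      · rintro ⟨s, a, ha, b, hb, rfl⟩
        exact ⟨_, ⟨a, ⟨s, ha⟩, rfl⟩, b, ⟨s, hb⟩, rfl⟩
    · intro x v s t hst
      simp only [Option.bind_eq_some_iff, Option.map_eq_some_iff]
      rintro ⟨a, ha, b, hb, rfl⟩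
      exact ⟨a, m₁ _ _ _ _ hst ha, b, m₂ _ _ _ _ hst hb, rfl⟩
  | @comp f h _ _ ihf ihh =>
    obtain ⟨g₁, hg₁, h₁, m₁⟩ := ihf
    obtain ⟨g₂, hg₂, h₂, m₂⟩ := ihh
    refine ⟨fun q => (g₂ q).bind fun b => g₁ (b, q.2), ?_, ?_, ?_⟩
    · exact Primrec.option_bind hg₂ (hg₁.comp (by fun_prop))
    · intro x v
      refine Part.mem_bind_iff.trans ?_
      simp only [h₁, h₂, Option.bind_eq_some_iff]
      constructor
      · rintro ⟨b, ⟨s, hs⟩, t, ht⟩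
        exact ⟨max s t, b, m₂ _ _ _ _ (le_max_left _ _) hs, m₁ _ _ _ _ (le_max_right _ _) ht⟩
      · rintro ⟨s, b, hb, h⟩
        exact ⟨b, ⟨s, hb⟩, s, h⟩
    · intro x v s t hst
      simp only [Option.bind_eq_some_iff]
      rintro ⟨b, hb, h⟩
      exact ⟨b, m₂ _ _ _ _ hst hb, m₁ _ _ _ _ hst h⟩
  | @prec f h _ _ ihf ihh =>
    obtain ⟨g₁, hg₁, h₁, m₁⟩ := ihf
    obtain ⟨g₂, hg₂, h₂, m₂⟩ := ihh
    let F : ℕ → ℕ → ℕ → ℕ → Option ℕ := fun a s σ n => Nat.rec (g₁ (a, s, σ))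
      (fun y ih => ih.bind fun i => g₂ (Nat.pair a (Nat.pair y i), s, σ)) n
    have mono : ∀ a v s t, s ≤ t → ∀ n, F a s (restrict A s) n = some v →
        F a t (restrict A t) n = some v := by
      intro a v s t hst n
      induction n generalizing v with
      | zero => exact m₁ _ _ _ _ hst
      | succ n ih =>
        simp only [F, Option.bind_eq_some_iff] at ih ⊢
        rintro ⟨i, hi, h⟩
        exact ⟨i, ih _ hi, m₂ _ _ _ _ hst h⟩
    refine ⟨fun q => F q.1.unpair.1 q.2.1 q.2.2 q.1.unpair.2, ?_, ?_, ?_⟩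
    · refine Primrec.nat_rec' (f := fun q : ℕ × ℕ × ℕ => q.1.unpair.2)
        (g := fun q => g₁ (q.1.unpair.1, q.2.1, q.2.2))
        (h := fun q p => p.2.bind fun i =>
          g₂ (Nat.pair q.1.unpair.1 (Nat.pair p.1 i), q.2.1, q.2.2)) ?_ ?_ ?_
      · fun_prop
      · exact hg₁.comp (by fun_prop)
      · refine Primrec.option_bind (by fun_prop) (hg₂.comp (primrec_mk ?_ (by fun_prop)))
        exact primrec_natPair (by fun_prop) (primrec_natPair (by fun_prop) (by fun_prop))
    · intro x v
      have key : ∀ a n v, v ∈ (Nat.rec (f a) (fun y IH => IH.bind fun i =>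
          h (Nat.pair a (Nat.pair y i))) n : Part ℕ) ↔ ∃ s, F a s (restrict A s) n = some v := by
        intro a n
        induction n with
        | zero => exact fun v => h₁ _ _
        | succ n ih =>
          intro v
          refine Part.mem_bind_iff.trans ?_
          simp only [ih, h₂, F, Option.bind_eq_some_iff]
          constructor
          · rintro ⟨i, ⟨s, hs⟩, t, ht⟩
            exact ⟨max s t, i, mono _ _ _ _ (le_max_left _ _) _ hs,
              m₂ _ _ _ _ (le_max_right _ _) ht⟩
          · rintro ⟨s, i, hi, h⟩
            exact ⟨i, ⟨s, hi⟩, s, h⟩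
      exact key _ _ _
    · exact fun x v s t hst => mono _ _ _ _ hst _
  | @rfind f _ ihf =>
    obtain ⟨g₁, hg₁, h₁, m₁⟩ := ihf
    -- At most one `n` satisfies `P q n`, so the greatest solution up to the length of the segment
    -- is the only one. Bounding by that length keeps the approximation primitive recursive.
    let P : ℕ × ℕ × ℕ → ℕ → Prop := fun q n => g₁ (Nat.pair q.1 n, q.2) = some 0 ∧
      ∀ m < n, g₁ (Nat.pair q.1 m, q.2) ≠ some 0 ∧ g₁ (Nat.pair q.1 m, q.2) ≠ none
    have hP : PrimrecPred fun r : (ℕ × ℕ × ℕ) × ℕ => P r.1 r.2 := by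
      have aux : ∀ {β : Type} [Primcodable β] {u : β → ℕ × ℕ × ℕ} {m : β → ℕ}, Primrec u →
          Primrec m → Primrec fun r => g₁ (Nat.pair (u r).1 (m r), (u r).2) :=
        fun hu hm => hg₁.comp (primrec_mk (primrec_natPair (by fun_prop) hm) (by fun_prop))
      refine primrecPred_and (primrecPred_eq (aux (by fun_prop) (by fun_prop)) (Primrec.const _))
        (primrecPred_forall_lt (by fun_prop) (primrecPred_and
          (primrecPred_not (primrecPred_eq (aux ?_ ?_) (Primrec.const _)))
          (primrecPred_not (primrecPred_eq (aux ?_ ?_) (Primrec.const _))))) <;> fun_prop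
    have uniq : ∀ q n n', P q n → P q n' → n = n' := fun q n n' h h' => by
      rcases lt_trichotomy n n' with hlt | rfl | hlt
      · exact absurd h.1 (h'.2 n hlt).1
      · rfl
      · exact absurd h'.1 (h.2 n' hlt).1
    have hg : ∀ q v, (if P q (Nat.findGreatest (P q) q.2.1) then
        some (Nat.findGreatest (P q) q.2.1) else none) = some v ↔ P q v ∧ v ≤ q.2.1 := by
      intro q v
      constructor
      · intro h
        split_ifs at h with hc
        rw [← Option.some.inj h]
        exact ⟨hc, Nat.findGreatest_le _⟩
      · rintro ⟨hv, hle⟩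
        have := Nat.findGreatest_spec hle hv
        rw [if_pos this, uniq q _ _ this hv]
    have mono : ∀ x n s t, s ≤ t → P (x, s, restrict A s) n → P (x, t, restrict A t) n := by
      intro x n s t hst h
      refine ⟨m₁ _ _ _ _ hst h.1, fun m hm => ?_⟩
      obtain ⟨w, hw⟩ := Option.ne_none_iff_exists'.1 (h.2 m hm).2
      have h1 := (h.2 m hm).1
      have h2 := m₁ _ _ _ _ hst hw
      simp only at h1 h2 hw ⊢
      rw [h2, ← hw]
      exact ⟨h1, by simp [hw]⟩
    refine ⟨fun q => if P q (Nat.findGreatest (P q) q.2.1) then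
        some (Nat.findGreatest (P q) q.2.1) else none, ?_, ?_, ?_⟩
    · have hfg : Primrec fun q : ℕ × ℕ × ℕ => Nat.findGreatest (P q) q.2.1 :=
        Primrec.nat_findGreatest (by fun_prop) hP
      exact Primrec.ite (hP.comp (Primrec.id.pair hfg)) (Primrec.option_some.comp hfg)
        (Primrec.const _)
    · intro x v
      simp only [hg]
      refine Nat.mem_rfind.trans ?_
      simp only [Part.map_eq_map, Part.mem_map_iff, h₁]
      constructor
      · rintro ⟨⟨w, ⟨s, hs⟩, hw⟩, hlt⟩
        have hw : w = 0 := by simpa using hw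
        subst hw
        have hex : ∀ m, ∃ t, m < v → g₁ (Nat.pair x m, t, restrict A t) ≠ some 0 ∧
            g₁ (Nat.pair x m, t, restrict A t) ≠ none := by
          intro m
          by_cases hm : m < v
          · obtain ⟨w, ⟨t, ht⟩, hw⟩ := hlt hm
            refine ⟨t, fun _ => ?_⟩
            rw [ht]
            simpa using hw
          · exact ⟨0, fun h => absurd h hm⟩
        choose t ht using hex
        -- A single stage must see all values of the search up to `v`, and must also exceed `v`
        -- itself because of the search bound.
        let N := max v (max s ((Finset.range v).sup t))
        refine ⟨N, ⟨m₁ _ _ _ _ (by simp [N]) hs, fun m hm => ?_⟩, by simp [N]⟩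
        obtain ⟨w, hw⟩ := Option.ne_none_iff_exists'.1 (ht m hm).2
        have h1 := (ht m hm).1
        have hle : t m ≤ N := le_max_of_le_right (le_max_of_le_right
          (Finset.le_sup (f := t) (Finset.mem_range.2 hm)))
        have h2 := m₁ _ _ _ _ hle hw
        simp only at h1 h2 hw ⊢
        rw [h2, ← hw]
        exact ⟨h1, by simp [hw]⟩
      · rintro ⟨s, ⟨h, h'⟩, -⟩
        refine ⟨⟨0, ⟨s, h⟩, by simp⟩, fun {m} hm => ?_⟩
        obtain ⟨w, hw⟩ := Option.ne_none_iff_exists'.1 (h' m hm).2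
        refine ⟨w, ⟨s, hw⟩, ?_⟩
        have h1 := (h' m hm).1
        simp only at h1 hw
        rw [hw] at h1
        simpa using h1
    · intro x v s t hst
      simp only [hg]
      rintro ⟨h, hle⟩
      exact ⟨mono _ _ _ _ hst h, hle.trans hst⟩

/-- The approximation from `exists_use` is itself a program on inputs `(x, s, restrict A s)`. All
its halting runs on segments of `A` agree, so the first one found by `functional` returns the right
value. -/
theorem exists_computes {A B : Set ℕ} (h : SetReducible B A) : ∃ e, Computes e A B := by
  obtain ⟨g, hg, hgf, -⟩ := exists_use (setReducible_iff.1 h)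
  have hp : Partrec fun n : ℕ => (g (n.unpair.1, n.unpair.2.unpair.1, n.unpair.2.unpair.2) : Part ℕ) :=
    Computable.ofOption (hg.comp (by fun_prop)).to_comp
  obtain ⟨c, hc⟩ := Nat.Partrec.Code.exists_code.1 (Partrec.nat_iff.1 hp)
  have hval : ∀ x s v, v ∈ c.eval (Nat.pair x (Nat.pair s (restrict A s))) ↔
      g (x, s, restrict A s) = some v := fun x s v => by
    rw [hc]
    simp
  refine ⟨Encodable.encode c, fun x => ?_⟩
  have hsound : ∀ v ∈ functional (Encodable.encode c) A x, v = charFn B x := by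
    intro v hv
    obtain ⟨T, t, -, h1, -⟩ := mem_functional_iff.1 hv
    rw [Denumerable.ofNat_encode] at h1
    exact Part.mem_some_iff.1 ((hgf x v).2 ⟨_, (hval _ _ _).1 (Nat.Partrec.Code.evaln_sound h1)⟩)
  have hdom : (functional (Encodable.encode c) A x).Dom := by
    obtain ⟨s, hs⟩ := (hgf x (charFn B x)).1 (Part.mem_some _)
    obtain ⟨k, hk⟩ := Nat.Partrec.Code.evaln_complete.1 ((hval _ _ _).2 hs)
    refine Nat.rfindOpt_dom.2 ⟨Nat.pair s k, charFn B x, ?_⟩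
    simpa using hk
  exact Part.eq_some_iff.2 (hsound _ (Part.get_mem hdom) ▸ Part.get_mem hdom)

end Use

/-! ### Collections of conditions that are Σ₃. -/

section Definability

theorem join_left_reducible (A B : Set ℕ) : SetReducible A (join A B) := by
  refine setReducible_iff.2 ((RecIn.charFn.comp (RecIn.of_primrec (f := fun n => 2 * n)
    (by fun_prop))).of_eq fun n => charFn_congr ⟨?_, fun h => Or.inl ⟨n, h, rfl⟩⟩)
  rintro (⟨x, hx, h⟩ | ⟨x, hx, h⟩)
  · rwa [show n = x by omega]
  · omega

theorem join_right_reducible (A B : Set ℕ) : SetReducible B (join A B) := by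
  refine setReducible_iff.2 ((RecIn.charFn.comp (RecIn.of_primrec (f := fun n => 2 * n + 1)
    (by fun_prop))).of_eq fun n => charFn_congr ⟨?_, fun h => Or.inr ⟨n, h, rfl⟩⟩)
  rintro (⟨x, hx, h⟩ | ⟨x, hx, h⟩)
  · omega
  · rwa [show n = x by omega]

theorem SetReducible.trans {A B C : Set ℕ} (h : SetReducible A B) (h' : SetReducible B C) :
    SetReducible A C := setReducible_iff.2 ((setReducible_iff.1 h).trans h')

theorem isSigma_three {J : Set ℕ} {τ : ℕ → ℕ} (hτ : RecIn J τ) {Q : ℕ → ℕ → Prop}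
    (hQ : PrimrecPred fun q : ℕ × ℕ => Q q.1 q.2) :
    IsSigma J 3 {c | ∃ w, ∀ b, ∃ t, Q (Nat.pair (Nat.pair (Nat.pair c w) b) t)
      (τ (Nat.pair (Nat.pair (Nat.pair c w) b) t))} := by
  refine ⟨{z | ∀ b, ∃ t, Q (Nat.pair (Nat.pair z b) t) (τ (Nat.pair (Nat.pair z b) t))},
    ⟨{z | ¬ ∃ t, Q (Nat.pair z t) (τ (Nat.pair z t))}, ⟨{z | Q z (τ z)}, ?_, ?_⟩, ?_⟩, ?_⟩
  · exact RecIn.reducible_of_primrecPred hτ (Q := fun n m => ¬ Q n m) (by fun_prop)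
  · intro x
    simp
  · intro x
    simp
  · intro x
    rfl

/-- A property of a condition, given by the canonical index of its finite part and by its infinite
part, is `Σ₂` relative to these and to the oracle `O`. -/
def IsSigmaTwoProperty (O : Set ℕ) (Φ : ℕ → Set ℕ → Prop) : Prop :=
  ∃ R : ℕ → ℕ → ℕ → ℕ → ℕ → Prop,
    PrimrecPred (fun q : ℕ × ℕ × ℕ × ℕ × ℕ => R q.1 q.2.1 q.2.2.1 q.2.2.2.1 q.2.2.2.2) ∧
    ∀ d S, Φ d S ↔ ∃ w, ∀ b, R d w b (restrict S b) (restrict O b)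

/-- The witness carries a tag choosing the disjunct. The tag does not depend on `b`, so it can be
read off at `b = 0`. -/
theorem IsSigmaTwoProperty.or {O : Set ℕ} {Φ Ψ : ℕ → Set ℕ → Prop} (h : IsSigmaTwoProperty O Φ)
    (h' : IsSigmaTwoProperty O Ψ) : IsSigmaTwoProperty O fun d S => Φ d S ∨ Ψ d S := by
  obtain ⟨R, hR, hΦ⟩ := h
  obtain ⟨R', hR', hΨ⟩ := h'
  refine ⟨fun d w b σ o => (w.unpair.1 = 0 ∧ R d w.unpair.2 b σ o) ∨
    (w.unpair.1 = 1 ∧ R' d w.unpair.2 b σ o), ?_, fun d S => ?_⟩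
  · refine primrecPred_or (primrecPred_and (by fun_prop) ?_) (primrecPred_and (by fun_prop) ?_)
    · exact hR.comp (f := fun q : ℕ × ℕ × ℕ × ℕ × ℕ => (q.1, q.2.1.unpair.2, q.2.2)) (by fun_prop)
    · exact hR'.comp (f := fun q : ℕ × ℕ × ℕ × ℕ × ℕ => (q.1, q.2.1.unpair.2, q.2.2)) (by fun_prop)
  · simp only [hΦ, hΨ]
    constructor
    · rintro (⟨w, hw⟩ | ⟨w, hw⟩)
      · exact ⟨Nat.pair 0 w, fun b => Or.inl (by simpa using hw b)⟩
      · exact ⟨Nat.pair 1 w, fun b => Or.inr (by simpa using hw b)⟩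
    · rintro ⟨w, hw⟩
      rcases hw 0 with ⟨h0, -⟩ | ⟨h0, -⟩
      · exact Or.inl ⟨w.unpair.2, fun b => by simpa [h0] using hw b⟩
      · exact Or.inr ⟨w.unpair.2, fun b => by simpa [h0] using hw b⟩

/-- The canonical index of the finite part of a condition. -/
def Condition.index (p : Condition) : ℕ := ∑ i ∈ p.D, 2 ^ i

theorem Condition.bits_index (p : Condition) : bits p.index = p.D := bits_sum_two_pow _

/-- The numbers `α` and `β` code initial segments of the oracles that suffice to verify that the
triple `c` behaves like the index of a condition `(D, S)` below `b`, that `σ` codes the first `b`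
bits of `S`, and that `m ≥ b` is in `S`. -/
def IndexWitness (c b T σ m α β : ℕ) : Prop :=
  (σ < 2 ^ b ∧ ∀ j < b,
    Conv c.unpair.2.unpair.1 (bits α) j (charFn (bits σ) j) T ∧
    Conv c.unpair.2.unpair.2 (bits β) j (charFn (bits σ) j) T ∧
    (j ∈ bits σ → ∀ i < c.unpair.1, i ∈ bits c.unpair.1 → i < j)) ∧
  (b ≤ m ∧ Conv c.unpair.2.unpair.1 (bits α) m 1 T)

theorem primrecPred_indexWitness : PrimrecPred fun q : ℕ × ℕ × ℕ × ℕ × ℕ × ℕ × ℕ =>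
    IndexWitness q.1 q.2.1 q.2.2.1 q.2.2.2.1 q.2.2.2.2.1 q.2.2.2.2.2.1 q.2.2.2.2.2.2 := by
  unfold IndexWitness
  fun_prop

/-- Being an index is Π₂: for each `b` some computations determine the first `b` bits of the
reservoir and exhibit an element at or above `b`. Merging this with the matrix of the Σ₂ property,
evaluated on the bits just determined, leaves the prefix `∃ w ∀ b ∃ t`. -/
theorem isDefinableCollection {I : Set (Set ℕ)} {A₀ A₁ O : Set ℕ} (hA : IsExactPair A₀ A₁ I)
    (hO : SetReducible O (join A₀ A₁)) {Φ : ℕ → Set ℕ → Prop} (hΦ : IsSigmaTwoProperty O Φ) :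
    IsDefinableCollection 3 I A₀ A₁ {p | p.S ∈ I ∧ Φ p.index p.S} := by
  obtain ⟨R, hR, hΦ⟩ := hΦ
  refine ⟨fun p hp => hp.1, ?_⟩
  let τ : ℕ → ℕ := fun n => Nat.pair (restrict A₀ n) (Nat.pair (restrict A₁ n) (restrict O n))
  have hτ : RecIn (join A₀ A₁) τ :=
    (RecIn.restrict_of_reducible (join_left_reducible _ _)).pair
      ((RecIn.restrict_of_reducible (join_right_reducible _ _)).pair
        (RecIn.restrict_of_reducible hO))
  -- Here `n` codes `(((c, w), b), (T, σ, m))`. As `T` and `b` are at most `n`, oracle segments of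
  -- length `n` are long enough.
  let Q : ℕ → ℕ → Prop := fun n k =>
    IndexWitness n.unpair.1.unpair.1.unpair.1 n.unpair.1.unpair.2 n.unpair.2.unpair.1
      n.unpair.2.unpair.2.unpair.1 n.unpair.2.unpair.2.unpair.2 k.unpair.1 k.unpair.2.unpair.1 ∧
    R n.unpair.1.unpair.1.unpair.1.unpair.1 n.unpair.1.unpair.1.unpair.2 n.unpair.1.unpair.2
      n.unpair.2.unpair.2.unpair.1 (k.unpair.2.unpair.2 % 2 ^ n.unpair.1.unpair.2)
  have hQ : PrimrecPred fun q : ℕ × ℕ => Q q.1 q.2 := by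
    refine primrecPred_and ?_ ?_
    · refine primrecPred_indexWitness.comp (f := fun q : ℕ × ℕ => (q.1.unpair.1.unpair.1.unpair.1,
        q.1.unpair.1.unpair.2, q.1.unpair.2.unpair.1, q.1.unpair.2.unpair.2.unpair.1,
        q.1.unpair.2.unpair.2.unpair.2, q.2.unpair.1, q.2.unpair.2.unpair.1)) ?_
      fun_prop
    · have hR' : ∀ {d w b σ o : ℕ × ℕ → ℕ}, Primrec d → Primrec w → Primrec b → Primrec σ →
          Primrec o → PrimrecPred fun q => R (d q) (w q) (b q) (σ q) (o q) :=
        fun hd hw hb hσ ho => hR.comp (hd.pair (hw.pair (hb.pair (hσ.pair ho))))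
      refine hR' ?_ ?_ ?_ ?_ (primrec_mod ?_ ?_) <;> fun_prop
  have hM : ∀ c w b T σ m, Q (Nat.pair (Nat.pair (Nat.pair c w) b) (Nat.pair T (Nat.pair σ m)))
      (τ (Nat.pair (Nat.pair (Nat.pair c w) b) (Nat.pair T (Nat.pair σ m)))) ↔
      ((σ < 2 ^ b ∧ ∀ j < b,
        Conv c.unpair.2.unpair.1 A₀ j (charFn (bits σ) j) T ∧
        Conv c.unpair.2.unpair.2 A₁ j (charFn (bits σ) j) T ∧
        (j ∈ bits σ → ∀ i < c.unpair.1, i ∈ bits c.unpair.1 → i < j)) ∧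
        (b ≤ m ∧ Conv c.unpair.2.unpair.1 A₀ m 1 T)) ∧
      R c.unpair.1 w b σ (restrict O b) := by
    intro c w b T σ m
    have h1 : T ≤ Nat.pair (Nat.pair (Nat.pair c w) b) (Nat.pair T (Nat.pair σ m)) :=
      (Nat.left_le_pair _ _).trans (Nat.right_le_pair _ _)
    have h2 : b ≤ Nat.pair (Nat.pair (Nat.pair c w) b) (Nat.pair T (Nat.pair σ m)) :=
      (Nat.right_le_pair _ _).trans (Nat.left_le_pair _ _)
    have h3 : restrict O (Nat.pair (Nat.pair (Nat.pair c w) b) (Nat.pair T (Nat.pair σ m))) % 2 ^ b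
        = restrict O b := eq_restrict fun i => by
      rw [mem_bits_mod, mem_bits_restrict]
      exact ⟨fun h => ⟨h.1, h.2.2⟩, fun h => ⟨h.1, h.1.trans_le h2, h.2⟩⟩
    simp only [Q, IndexWitness, τ, Nat.unpair_pair]
    simp only [conv_bits_restrict h1, h3]
  have hset : {c | ∃ p ∈ {p : Condition | p.S ∈ I ∧ Φ p.index p.S}, IsIndex A₀ A₁ c p} =
      {c | ∃ w, ∀ b, ∃ t, Q (Nat.pair (Nat.pair (Nat.pair c w) b) t)
        (τ (Nat.pair (Nat.pair (Nat.pair c w) b) t))} := by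
    ext c
    constructor
    · rintro ⟨p, ⟨hpI, hp⟩, hd, h0, h1⟩
      have hd : c.unpair.1 = p.index := hd
      obtain ⟨w, hw⟩ := (hΦ _ _).1 hp
      refine ⟨w, fun b => ?_⟩
      obtain ⟨m, hm, hbm⟩ := p.infinite.exists_gt b
      choose T₀ hT₀ using h0.conv
      choose T₁ hT₁ using h1.conv
      let T := max (T₀ m) (max ((Finset.range b).sup T₀) ((Finset.range b).sup T₁))
      refine ⟨Nat.pair T (Nat.pair (restrict p.S b) m), (hM _ _ _ _ _ _).2
        ⟨⟨⟨restrict_lt _ _, fun j hj => ?_⟩, hbm.le, ?_⟩, ?_⟩⟩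
      · have hc : charFn (bits (restrict p.S b)) j = charFn p.S j :=
          charFn_congr (by simp [mem_bits_restrict, hj])
        rw [hc]
        refine ⟨(hT₀ j).mono ?_, (hT₁ j).mono ?_, fun hjS i _ hi => ?_⟩
        · exact le_max_of_le_right (le_max_of_le_left
            (Finset.le_sup (f := T₀) (Finset.mem_range.2 hj)))
        · exact le_max_of_le_right (le_max_of_le_right
            (Finset.le_sup (f := T₁) (Finset.mem_range.2 hj)))
        · rw [hd, p.bits_index] at hi
          exact p.lt i hi j (mem_bits_restrict.1 hjS).2
      · have := (hT₀ m).mono (le_max_left _ _ : T₀ m ≤ T)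
        rwa [charFn_of_mem hm] at this
      · rw [hd]
        exact hw b
    · rintro ⟨w, hw⟩
      choose t ht using hw
      have ht : ∀ b, _ := fun b => (hM c w b (t b).unpair.1 (t b).unpair.2.unpair.1
        (t b).unpair.2.unpair.2).1 (by simpa using ht b)
      -- The reservoir is read off from the first functional; uniqueness of values makes every `σ`
      -- an initial segment of it.
      let S : Set ℕ := {n | ∃ T, Conv c.unpair.2.unpair.1 A₀ n 1 T}
      have hS : ∀ b, ∀ j < b, j ∈ bits (t b).unpair.2.unpair.1 ↔ j ∈ S := by
        intro b j hj
        have h := ((ht b).1.1.2 j hj).1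
        constructor
        · intro hm
          rw [charFn_of_mem hm] at h
          exact ⟨_, h⟩
        · rintro ⟨T, hT⟩
          exact charFn_eq_one.1 (h.unique hT)
      have hres : ∀ b, (t b).unpair.2.unpair.1 = restrict S b := fun b => eq_restrict fun i =>
        ⟨fun h => have hi := lt_of_mem_bits_of_lt h (ht b).1.1.1
          ⟨hi, (hS b i hi).1 h⟩, fun h => (hS b i h.1).2 h.2⟩
      have hch : ∀ j, charFn (bits (t (j + 1)).unpair.2.unpair.1) j = charFn S j := fun j =>
        charFn_congr (hS _ _ (Nat.lt_succ_self j))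
      have hinf : S.Infinite := Set.infinite_of_forall_exists_gt fun b =>
        ⟨_, ⟨_, (ht (b + 1)).1.2.2⟩, (ht (b + 1)).1.2.1⟩
      have h0 : Computes c.unpair.2.unpair.1 A₀ S := computes_iff.2 fun x =>
        ⟨_, hch x ▸ ((ht (x + 1)).1.1.2 x (Nat.lt_succ_self x)).1⟩
      have h1 : Computes c.unpair.2.unpair.2 A₁ S := computes_iff.2 fun x =>
        ⟨_, hch x ▸ ((ht (x + 1)).1.1.2 x (Nat.lt_succ_self x)).2.1⟩
      let p : Condition := ⟨bitFinset c.unpair.1, S, hinf, fun i hi s hs =>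
        ((ht (s + 1)).1.1.2 s (Nat.lt_succ_self s)).2.2 ((hS _ _ (Nat.lt_succ_self s)).2 hs) i
          (lt_of_mem_bits (mem_bitFinset.1 hi)) (mem_bitFinset.1 hi)⟩
      have hd : p.index = c.unpair.1 := sum_bitFinset _
      refine ⟨p, ⟨(hA S).2 ⟨h0.reducible, h1.reducible⟩, (hΦ _ _).2 ⟨w, fun b => ?_⟩⟩,
        hd.symm, h0, h1⟩
      rw [hd, ← hres b]
      exact (ht b).2
  rw [hset]
  exact isSigma_three hτ hQ

end Definability

/-! ### The clauses to be forced, and their Σ₂ form. -/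

section Clauses

/-- The condition with finite part coded by `d` and infinite part `S` bounds `Φ_i^G`. -/
def ForcesBounded (i d : ℕ) (S : Set ℕ) : Prop :=
  ∃ n, ∀ a y T, bits d ⊆ bits a → bits a ⊆ bits d ∪ S → n < y → ¬ Conv i (bits a) y 1 T

/-- The condition forces `Φ_i^G` to contain a number outside of `G`. -/
def ForcesNotSubset (i d : ℕ) (S : Set ℕ) : Prop :=
  ∃ y u, Conv i (bits d) y 1 u ∧ y ∉ bits d ∧ y < u ∧ ∀ s ∈ S, u ≤ s

/-- The condition forces a finite subset of `Φ_i^G` to give a wrong answer about `G`. -/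
def ForcesError (P : ℕ → ℕ → ℕ → ℕ → Prop) (i d : ℕ) (S : Set ℕ) : Prop :=
  ∃ x f v u T, x < u ∧ (∀ j ∈ bits f, Conv i (bits d) j 1 u) ∧ P x f v T ∧
    v ≠ charFn (bits d) x ∧ ∀ s ∈ S, u ≤ s

/-- No finite subset of `S` gives an answer at some fixed argument. -/
def ForcesUndefined (P : ℕ → ℕ → ℕ → ℕ → Prop) (S : Set ℕ) : Prop :=
  ∃ x, ∀ f v T, bits f ⊆ S → ¬ P x f v T

theorem le_iff_forall_restrict {S : Set ℕ} {u : ℕ} :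
    (∀ s ∈ S, u ≤ s) ↔ ∀ b, ∀ j < b, j ∈ bits (restrict S b) → u ≤ j := by
  simp only [mem_bits_restrict]
  exact ⟨fun h b j _ hj => h j hj.2, fun h s hs => h (s + 1) s s.lt_succ_self
    ⟨s.lt_succ_self, hs⟩⟩

theorem bits_subset_iff {a : ℕ} {B : Set ℕ} : bits a ⊆ B ↔ ∀ j < a, j ∈ bits a → j ∈ B :=
  ⟨fun h _ _ hj => h hj, fun h _ hj => h _ (lt_of_mem_bits hj) hj⟩

theorem bits_subset_union_iff {a d b : ℕ} {S : Set ℕ} (hab : a ≤ b) :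
    bits a ⊆ bits d ∪ S ↔ ∀ j < a, j ∈ bits a → j ∈ bits d ∨ j ∈ bits (restrict S b) := by
  rw [bits_subset_iff]
  refine forall₂_congr fun j hj => ?_
  rw [mem_bits_restrict, and_iff_right (hj.trans_le hab)]
  rfl

theorem bits_subset_iff_restrict {a b : ℕ} {S : Set ℕ} (hab : a ≤ b) :
    bits a ⊆ S ↔ ∀ j < a, j ∈ bits a → j ∈ bits (restrict S b) := by
  rw [bits_subset_iff]
  refine forall₂_congr fun j hj => ?_
  rw [mem_bits_restrict, and_iff_right (hj.trans_le hab)]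

theorem isSigmaTwoProperty_forcesBounded (O : Set ℕ) (i : ℕ) :
    IsSigmaTwoProperty O (ForcesBounded i) := by
  -- The universal number `b` codes the triple `(a, y, T)`. Since `a ≤ b`, the first `b` bits of `S`
  -- decide whether `bits a ⊆ bits d ∪ S`.
  refine ⟨fun d w b σ _ => (∀ j < d, j ∈ bits d → j ∈ bits b.unpair.1) →
    (∀ j < b.unpair.1, j ∈ bits b.unpair.1 → j ∈ bits d ∨ j ∈ bits σ) → w < b.unpair.2.unpair.1 →
    ¬ Conv i (bits b.unpair.1) b.unpair.2.unpair.1 1 b.unpair.2.unpair.2, by fun_prop,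
    fun d S => exists_congr fun n => ?_⟩
  constructor
  · intro h b h1 h2
    exact h _ _ _ (bits_subset_iff.2 h1) ((bits_subset_union_iff (Nat.unpair_left_le b)).2 h2)
  · intro h a y T h1 h2
    have := h (Nat.pair a (Nat.pair y T))
    simp only [Nat.unpair_pair] at this
    exact this (bits_subset_iff.1 h1) ((bits_subset_union_iff (Nat.left_le_pair _ _)).1 h2)

theorem isSigmaTwoProperty_forcesNotSubset (O : Set ℕ) (i : ℕ) :
    IsSigmaTwoProperty O (ForcesNotSubset i) := by
  refine ⟨fun d w b σ _ => (Conv i (bits d) w.unpair.1 1 w.unpair.2 ∧ w.unpair.1 ∉ bits d ∧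
    w.unpair.1 < w.unpair.2) ∧ ∀ j < b, j ∈ bits σ → w.unpair.2 ≤ j, by fun_prop, fun d S => ?_⟩
  simp only [ForcesNotSubset, le_iff_forall_restrict]
  constructor
  · rintro ⟨y, u, h1, h2, h3, h4⟩
    exact ⟨Nat.pair y u, fun b => by simpa using ⟨⟨h1, h2, h3⟩, h4 b⟩⟩
  · rintro ⟨w, hw⟩
    exact ⟨_, _, (hw 0).1.1, (hw 0).1.2.1, (hw 0).1.2.2, fun b => (hw b).2⟩

theorem isSigmaTwoProperty_forcesError (O : Set ℕ) (i : ℕ) {P : ℕ → ℕ → ℕ → ℕ → Prop}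
    (hP : PrimrecPred fun q : ℕ × ℕ × ℕ × ℕ => P q.1 q.2.1 q.2.2.1 q.2.2.2) :
    IsSigmaTwoProperty O (ForcesError P i) := by
  have hP' : PrimrecPred fun w : ℕ => P w.unpair.1 w.unpair.2.unpair.1 w.unpair.2.unpair.2.unpair.1
      w.unpair.2.unpair.2.unpair.2.unpair.2 := by
    refine hP.comp (f := fun w : ℕ => (w.unpair.1, w.unpair.2.unpair.1,
      w.unpair.2.unpair.2.unpair.1, w.unpair.2.unpair.2.unpair.2.unpair.2)) ?_
    fun_prop
  refine ⟨fun d w b σ _ => (w.unpair.1 < w.unpair.2.unpair.2.unpair.2.unpair.1 ∧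
    (∀ j < w.unpair.2.unpair.1, j ∈ bits w.unpair.2.unpair.1 →
      Conv i (bits d) j 1 w.unpair.2.unpair.2.unpair.2.unpair.1) ∧
    P w.unpair.1 w.unpair.2.unpair.1 w.unpair.2.unpair.2.unpair.1
      w.unpair.2.unpair.2.unpair.2.unpair.2 ∧
    w.unpair.2.unpair.2.unpair.1 ≠ charFn (bits d) w.unpair.1) ∧
    ∀ j < b, j ∈ bits σ → w.unpair.2.unpair.2.unpair.2.unpair.1 ≤ j, ?_, fun d S => ?_⟩
  · refine primrecPred_and (primrecPred_and (by fun_prop) (primrecPred_and (by fun_prop)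
      (primrecPred_and ?_ (primrecPred_not (by fun_prop))))) (by fun_prop)
    exact hP'.comp (f := fun q : ℕ × ℕ × ℕ × ℕ × ℕ => q.2.1) (by fun_prop)
  · simp only [ForcesError, le_iff_forall_restrict]
    constructor
    · rintro ⟨x, f, v, u, T, h1, h2, h3, h4, h5⟩
      refine ⟨Nat.pair x (Nat.pair f (Nat.pair v (Nat.pair u T))), fun b => ?_⟩
      simp only [Nat.unpair_pair]
      exact ⟨⟨h1, fun j _ => h2 j, h3, h4⟩, h5 b⟩
    · rintro ⟨w, hw⟩
      exact ⟨_, _, _, _, _, (hw 0).1.1, fun j hj => (hw 0).1.2.1 j (lt_of_mem_bits hj) hj,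
        (hw 0).1.2.2.1, (hw 0).1.2.2.2, fun b => (hw b).2⟩

theorem isSigmaTwoProperty_forcesUndefined (O : Set ℕ) {P : ℕ → ℕ → ℕ → ℕ → Prop}
    (hP : PrimrecPred fun q : ℕ × ℕ × ℕ × ℕ => P q.1 q.2.1 q.2.2.1 q.2.2.2) :
    IsSigmaTwoProperty O fun _ => ForcesUndefined P := by
  refine ⟨fun _ w b σ _ => (∀ j < b.unpair.1, j ∈ bits b.unpair.1 → j ∈ bits σ) →
    ¬ P w b.unpair.1 b.unpair.2.unpair.1 b.unpair.2.unpair.2, ?_,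
    fun d S => exists_congr fun x => ?_⟩
  · refine primrecPred_imp (by fun_prop) (primrecPred_not ?_)
    refine hP.comp (f := fun q : ℕ × ℕ × ℕ × ℕ × ℕ => (q.2.1, q.2.2.1.unpair.1,
      q.2.2.1.unpair.2.unpair.1, q.2.2.1.unpair.2.unpair.2)) ?_
    fun_prop
  · constructor
    · intro h b h1
      exact h _ _ _ ((bits_subset_iff_restrict (Nat.unpair_left_le b)).2 h1)
    · intro h f v T hf
      have := h (Nat.pair f (Nat.pair v T))
      simp only [Nat.unpair_pair] at this
      exact this ((bits_subset_iff_restrict (Nat.left_le_pair _ _)).1 hf)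

/-- The condition forces an initial segment of the generic set `H` to give a wrong answer about
the oracle `O`. -/
def ForcesWrong (O : Set ℕ) (e d : ℕ) (S : Set ℕ) : Prop :=
  ∃ x v u, Conv e (bits d) x v u ∧ v ≠ charFn O x ∧ ∀ s ∈ S, u ≤ s

/-- The condition forces `Φ_e^H` to be undefined somewhere. -/
def ForcesDivergence (e d : ℕ) (S : Set ℕ) : Prop :=
  ∃ x, ∀ a v T, bits d ⊆ bits a → bits a ⊆ bits d ∪ S → ¬ Conv e (bits a) x v T

theorem isSigmaTwoProperty_forcesWrong (O : Set ℕ) (e : ℕ) :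
    IsSigmaTwoProperty O (ForcesWrong O e) := by
  -- The bit of `O` at `x` is visible only once `x < b`; for smaller `b` the clause is vacuous.
  refine ⟨fun d w b σ o => Conv e (bits d) w.unpair.1 w.unpair.2.unpair.1 w.unpair.2.unpair.2 ∧
    (w.unpair.1 < b → ¬ w.unpair.2.unpair.1 = charFn (bits o) w.unpair.1) ∧
    ∀ j < b, j ∈ bits σ → w.unpair.2.unpair.2 ≤ j, by fun_prop, fun d S => ?_⟩
  simp only [ForcesWrong, le_iff_forall_restrict]
  have key : ∀ {x b}, x < b → charFn (bits (restrict O b)) x = charFn O x := fun h =>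
    charFn_congr (mem_bits_restrict.trans (and_iff_right h))
  constructor
  · rintro ⟨x, v, u, h1, h2, h3⟩
    refine ⟨Nat.pair x (Nat.pair v u), fun b => ?_⟩
    simp only [Nat.unpair_pair]
    exact ⟨h1, fun hx => (key hx).symm ▸ h2, h3 b⟩
  · rintro ⟨w, hw⟩
    refine ⟨_, _, _, (hw 0).1, ?_, fun b => (hw b).2.2⟩
    have := (hw (w.unpair.1 + 1)).2.1 (Nat.lt_succ_self _)
    rwa [key (Nat.lt_succ_self _)] at this

theorem isSigmaTwoProperty_forcesDivergence (O : Set ℕ) (e : ℕ) :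
    IsSigmaTwoProperty O (ForcesDivergence e) := by
  refine ⟨fun d w b σ _ => (∀ j < d, j ∈ bits d → j ∈ bits b.unpair.1) →
    (∀ j < b.unpair.1, j ∈ bits b.unpair.1 → j ∈ bits d ∨ j ∈ bits σ) →
    ¬ Conv e (bits b.unpair.1) w b.unpair.2.unpair.1 b.unpair.2.unpair.2, by fun_prop,
    fun d S => exists_congr fun n => ?_⟩
  constructor
  · intro h b h1 h2
    exact h _ _ _ (bits_subset_iff.2 h1) ((bits_subset_union_iff (Nat.unpair_left_le b)).2 h2)
  · intro h a y T h1 h2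
    have := h (Nat.pair a (Nat.pair y T))
    simp only [Nat.unpair_pair] at this
    exact this (bits_subset_iff.1 h1) ((bits_subset_union_iff (Nat.left_le_pair _ _)).1 h2)

theorem isSigmaTwoProperty_exists_ge (O : Set ℕ) (N : ℕ) :
    IsSigmaTwoProperty O fun d _ => ∃ j ∈ bits d, N ≤ j :=
  ⟨fun d w _ _ _ => w ∈ bits d ∧ N ≤ w, by fun_prop, fun d S => by simp⟩

end Clauses

/-! ### Density, by growing two disagreeing finite sets together. -/

section Density

theorem mem_bits_of_mod_eq {a a' u j : ℕ} (h : a' % 2 ^ u = a) (hj : j < u) :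
    j ∈ bits a' ↔ j ∈ bits a := by
  rw [← h, mem_bits_mod, and_iff_right hj]

theorem bits_subset_of_mod_eq {a a' u : ℕ} (h : a' % 2 ^ u = a) : bits a ⊆ bits a' := by
  rw [← h]
  exact fun j hj => (mem_bits_mod.1 hj).2

/-- Extensions taken from a reservoir at or above `u` are end extensions, the form in which
`SplitStep` can be checked arithmetically. -/
theorem mod_eq_of_bits {a a' u : ℕ} {Z : Set ℕ} (ha : a < 2 ^ u) (hZ : ∀ z ∈ Z, u ≤ z)
    (h : bits a ⊆ bits a') (h' : bits a' ⊆ bits a ∪ Z) : a' % 2 ^ u = a := by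
  refine bits_injective (Set.ext fun j => mem_bits_mod.trans ⟨?_, fun hj =>
    ⟨lt_of_mem_bits_of_lt hj ha, h hj⟩⟩)
  rintro ⟨hju, hj⟩
  exact (h' hj).resolve_right fun hz => absurd hju (not_lt.2 (hZ j hz))

theorem bits_subset_union_of_mod_eq {a a' u : ℕ} {D S : Set ℕ} (h : a' % 2 ^ u = a)
    (ha : bits a ⊆ D ∪ S) (hS : ∀ j ∈ bits a', u ≤ j → j ∈ S) : bits a' ⊆ D ∪ S := by
  intro j hj
  rcases lt_or_ge j u with hju | hju
  · exact ha ((mem_bits_of_mod_eq h hju).1 hj)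
  · exact Or.inr (hS j hj hju)

/-- The elements of `S` that are at least `u`. -/
def tail (S : Set ℕ) (u : ℕ) : Set ℕ := {z | z ∈ S ∧ u ≤ z}

theorem infinite_tail {S : Set ℕ} (hS : S.Infinite) (u : ℕ) : (tail S u).Infinite := by
  refine (hS.sdiff (Set.finite_lt_nat u)).mono fun z hz => ⟨hz.1, ?_⟩
  exact not_lt.1 hz.2

theorem reducible_of_primrecPred_mem {S : Set ℕ} {Q : ℕ → Prop → Prop}
    (h : PrimrecPred fun q : ℕ × ℕ => Q q.1 (q.2 = 1)) :
    SetReducible {n | Q n (n ∈ S)} S := by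
  have := RecIn.reducible_of_primrecPred (RecIn.charFn (A := S)) (Q := fun n m => Q n (m = 1)) h
  simpa only [charFn_eq_one] using this

theorem tail_reducible (S : Set ℕ) (u : ℕ) : SetReducible (tail S u) S :=
  reducible_of_primrecPred_mem (Q := fun n p => p ∧ u ≤ n) (by fun_prop)

/-- An infinite set `W` that is computably enumerable in `S` has an infinite `S`-computable
subset. -/
theorem exists_infinite_reducible_subset {S P W : Set ℕ} (hP : SetReducible P S)
    (hW : ∀ y, y ∈ W ↔ ∃ t, Nat.pair y t ∈ P) (hinf : ∀ n, ∃ y ∈ W, n < y) :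
    ∃ Z ⊆ W, Z.Infinite ∧ SetReducible Z S := by
  have hP' : SetReducible {n | n.unpair.1 < n.unpair.2.unpair.1 ∧ n.unpair.2 ∈ P} S := by
    have := RecIn.reducible_of_primrecPred (A := S)
      (Q := fun n m => n.unpair.1 < n.unpair.2.unpair.1 ∧ m = 1)
      ((setReducible_iff.1 hP).comp (RecIn.of_primrec (f := fun n => n.unpair.2) (by fun_prop)))
      (by fun_prop)
    simpa only [charFn_eq_one] using this
  obtain ⟨f, hf, -, hfP⟩ := RecIn.exists_seq hP' (fun _ => True) 0 trivial
    (fun a _ => by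
      obtain ⟨y, hy, hay⟩ := hinf a
      obtain ⟨t, ht⟩ := (hW y).1 hy
      exact ⟨Nat.pair y t, by simpa using ⟨hay, ht⟩⟩) fun _ _ _ _ => trivial
  simp only [Set.mem_ofPred_eq, Nat.unpair_pair] at hfP
  have hmono : StrictMono fun k => f (k + 1) := strictMono_nat_of_lt_succ fun k => by
    obtain ⟨-, t, h, -⟩ := hfP (k + 1)
    exact h
  refine ⟨Set.range fun k => f (k + 1), ?_, Set.infinite_range_of_injective hmono.injective,
    RecIn.reducible_range (hf.comp (RecIn.of_primrec Primrec.succ)) hmono⟩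
  rintro _ ⟨k, rfl⟩
  obtain ⟨-, t, -, h⟩ := hfP k
  exact (hW _).2 ⟨t, h⟩

/-- Two finite sets, coded by `a` and `b` and included in `[0, u)`, that extend the finite part
coded by `d` by elements of `S`, and that disagree at `x`. -/
def Split (d : ℕ) (S : Set ℕ) (x a b u : ℕ) : Prop :=
  (a < 2 ^ u ∧ b < 2 ^ u ∧ x < u) ∧ (bits d ⊆ bits a ∧ bits a ⊆ bits d ∪ S ∧ x ∈ bits a) ∧
    (bits d ⊆ bits b ∧ bits b ⊆ bits d ∪ S ∧ x ∉ bits b)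

/-- End extensions `a'` and `b'` of `a` and `b` by elements of the set coded by `σ`, such that both
`Φ_i^{a'}` and `Φ_i^{b'}` contain the element `y` of that set. -/
def SplitStep (i σ a b u a' b' u' y : ℕ) : Prop :=
  (a' < 2 ^ u' ∧ b' < 2 ^ u') ∧ (a' % 2 ^ u = a ∧ b' % 2 ^ u = b) ∧
    (∀ j < a', j ∈ bits a' → u ≤ j → j ∈ bits σ) ∧
    (∀ j < b', j ∈ bits b' → u ≤ j → j ∈ bits σ) ∧
    (u ≤ y ∧ y < u' ∧ y ∈ bits σ) ∧ Conv i (bits a') y 1 u' ∧ Conv i (bits b') y 1 u'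

theorem primrecPred_splitStep {α : Type*} [Primcodable α] {i : ℕ} {σ a b u a' b' u' y : α → ℕ}
    (hσ : Primrec σ) (ha : Primrec a) (hb : Primrec b) (hu : Primrec u) (ha' : Primrec a')
    (hb' : Primrec b') (hu' : Primrec u') (hy : Primrec y) : PrimrecPred fun q =>
      SplitStep i (σ q) (a q) (b q) (u q) (a' q) (b' q) (u' q) (y q) := by
  unfold SplitStep
  refine primrecPred_and (by fun_prop) (primrecPred_and (primrecPred_and
    (primrecPred_eq (primrec_mod ha' (by fun_prop)) ha)
    (primrecPred_eq (primrec_mod hb' (by fun_prop)) hb)) (by fun_prop))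

theorem Split.step {d : ℕ} {S : Set ℕ} {x i n a b u a' b' u' y : ℕ} (h : Split d S x a b u)
    (h' : SplitStep i (restrict S n) a b u a' b' u' y) : Split d S x a' b' u' := by
  obtain ⟨⟨h1, h2, h3⟩, ⟨h4, h5, h6⟩, h7, h8, h9⟩ := h
  obtain ⟨⟨k1, k2⟩, ⟨k3, k4⟩, k5, k6, ⟨k7, k8, -⟩, -⟩ := h'
  refine ⟨⟨k1, k2, by omega⟩, ⟨h4.trans (bits_subset_of_mod_eq k3), ?_, ?_⟩,
    h7.trans (bits_subset_of_mod_eq k4), ?_, ?_⟩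
  · exact bits_subset_union_of_mod_eq k3 h5 fun j hj hju =>
      (mem_bits_restrict.1 (k5 j (lt_of_mem_bits hj) hj hju)).2
  · exact (mem_bits_of_mod_eq k3 h3).2 h6
  · exact bits_subset_union_of_mod_eq k4 h8 fun j hj hju =>
      (mem_bits_restrict.1 (k6 j (lt_of_mem_bits hj) hj hju)).2
  · exact fun hx => h9 ((mem_bits_of_mod_eq k4 h3).1 hx)

/-- The step of the construction: common elements of `Φ_i^{a'}` and `Φ_i^{b'}` can be found if no
extension of `(d, S)` bounds `Φ_i^G` or forces that it is not a subset of `G`. -/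
theorem Split.exists_step {d : ℕ} {S : Set ℕ} {x i a b u : ℕ} (hS : S.Infinite)
    (hdu : ∀ j ∈ bits d, j < u)
    (hbdd : ∀ a Z u, Z ⊆ S → Z.Infinite → SetReducible Z S → a < 2 ^ u → (∀ z ∈ Z, u ≤ z) →
      bits d ⊆ bits a → bits a ⊆ bits d ∪ S → ¬ ForcesBounded i a Z)
    (hsub : ∀ a Z u, Z ⊆ S → Z.Infinite → SetReducible Z S → a < 2 ^ u → (∀ z ∈ Z, u ≤ z) →
      bits d ⊆ bits a → bits a ⊆ bits d ∪ S → ¬ ForcesNotSubset i a Z)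
    (h : Split d S x a b u) :
    ∃ a' b' u' y, ∀ n, u' ≤ n → a' ≤ n → b' ≤ n →
      SplitStep i (restrict S n) a b u a' b' u' y := by
  obtain ⟨⟨h1, h2, h3⟩, ⟨h4, h5, h6⟩, h7, h8, h9⟩ := h
  -- If `y` were missing from `a'`, discarding the reservoir below the use and below `y + 1` would
  -- force `y` into `Φ_i^G` and out of `G`. As `bits d` lies below `u ≤ y`, the element `y` must
  -- come from `S`.
  have hmem : ∀ a' y T, bits d ⊆ bits a' → bits a' ⊆ bits d ∪ S → Conv i (bits a') y 1 T →
      u ≤ y → y ∈ bits a' ∧ y ∈ S := by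
    intro a' y T k1 k2 k3 k4
    have hy : y ∈ bits a' := by
      by_contra hy
      refine hsub a' (tail S (max (max T (y + 1)) a')) (max (max T (y + 1)) a') (fun z hz => hz.1)
        (infinite_tail hS _) (tail_reducible _ _) ?_ (fun z hz => hz.2) k1 k2
        ⟨y, max (max T (y + 1)) a', k3.mono (by simp), hy, by simp, fun z hz => hz.2⟩
      exact Nat.lt_two_pow_self.trans_le (Nat.pow_le_pow_right two_pos (le_max_right _ _))
    refine ⟨hy, (k2 hy).resolve_left fun hyd => ?_⟩
    have := hdu y hyd
    omega
  let P : Set ℕ := {n | u ≤ n.unpair.1 ∧ n.unpair.2.unpair.1 % 2 ^ u = a ∧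
    (∀ j < n.unpair.2.unpair.1, j ∈ bits n.unpair.2.unpair.1 → u ≤ j →
      j ∈ bits (restrict S n)) ∧ Conv i (bits n.unpair.2.unpair.1) n.unpair.1 1 n.unpair.2.unpair.2}
  have hP : SetReducible P S := RecIn.reducible_of_primrecPred RecIn.restrict
    (Q := fun n m => u ≤ n.unpair.1 ∧ n.unpair.2.unpair.1 % 2 ^ u = a ∧
    (∀ j < n.unpair.2.unpair.1, j ∈ bits n.unpair.2.unpair.1 → u ≤ j →
      j ∈ bits m) ∧ Conv i (bits n.unpair.2.unpair.1) n.unpair.1 1 n.unpair.2.unpair.2)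
    (by fun_prop)
  let W : Set ℕ := {y | u ≤ y ∧ ∃ a' T, a' % 2 ^ u = a ∧ (∀ j ∈ bits a', u ≤ j → j ∈ S) ∧
    Conv i (bits a') y 1 T}
  have hWP : ∀ y, y ∈ W ↔ ∃ t, Nat.pair y t ∈ P := by
    intro y
    constructor
    · rintro ⟨k1, a', T, k2, k3, k4⟩
      refine ⟨Nat.pair a' T, ?_⟩
      simp only [P, Set.mem_ofPred_eq, Nat.unpair_pair]
      exact ⟨k1, k2, fun j hj hja hju => mem_bits_restrict.2 ⟨hj.trans_le
        ((Nat.left_le_pair _ _).trans (Nat.right_le_pair _ _)), k3 j hja hju⟩, k4⟩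
    · rintro ⟨t, ht⟩
      simp only [P, Set.mem_ofPred_eq, Nat.unpair_pair] at ht
      obtain ⟨k1, k2, k3, k4⟩ := ht
      exact ⟨k1, _, _, k2, fun j hj hju =>
        (mem_bits_restrict.1 (k3 j (lt_of_mem_bits hj) hj hju)).2, k4⟩
  have hunb : ∀ a Z, Z ⊆ S → Z.Infinite → SetReducible Z S → a < 2 ^ u → (∀ z ∈ Z, u ≤ z) →
      bits d ⊆ bits a → bits a ⊆ bits d ∪ S → ∀ n, ∃ a' y T, bits a ⊆ bits a' ∧
        bits a' ⊆ bits a ∪ Z ∧ n < y ∧ Conv i (bits a') y 1 T := by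
    intro a Z k1 k2 k3 k4 k5 k6 k7 n
    have := hbdd a Z u k1 k2 k3 k4 k5 k6 k7
    unfold ForcesBounded at this
    push Not at this
    exact this n
  have hWS : W ⊆ S := by
    rintro y ⟨k1, a', T, k2, k3, k4⟩
    exact (hmem a' y T (h4.trans (bits_subset_of_mod_eq k2))
      (bits_subset_union_of_mod_eq k2 h5 k3) k4 k1).2
  -- `W` collects the numbers that the first side can enumerate. It is unbounded and computably
  -- enumerable in `S`; thinning it to a computable `Z` provides a legitimate reservoir for the
  -- second side.
  obtain ⟨Z, hZW, hZinf, hZS⟩ := exists_infinite_reducible_subset hP hWP fun n => by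
    obtain ⟨a', y, T, k1, k2, k3, k4⟩ := hunb a (tail S u) (fun z hz => hz.1) (infinite_tail hS _)
      (tail_reducible _ _) h1 (fun z hz => hz.2) h4 h5 (max n u)
    have k5 := mod_eq_of_bits h1 (fun z (hz : z ∈ tail S u) => hz.2) k1 k2
    refine ⟨y, ⟨(le_max_right n u).trans k3.le, a', T, k5, fun j hj hju => ?_, k4⟩,
      (le_max_left n u).trans_lt k3⟩
    refine (k2 hj).elim (fun hja => ?_) fun hjt => hjt.1
    have := lt_of_mem_bits_of_lt hja h1
    omega
  -- Extending the second side by elements of `Z` only makes its new value `y` belong to `Z ⊆ W`, so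
  -- the first side has an extension enumerating the same `y`.
  obtain ⟨b', y, T, k1, k2, k3, k4⟩ := hunb b Z (hZW.trans hWS) hZinf hZS h2
    (fun z hz => (hZW hz).1) h7 h8 u
  have k5 := mod_eq_of_bits h2 (fun z hz => (hZW hz).1) k1 k2
  have k6 : ∀ j ∈ bits b', u ≤ j → j ∈ Z := fun j hj hju => (k2 hj).resolve_left fun hjb => by
    have := lt_of_mem_bits_of_lt hjb h2
    omega
  have k7 : ∀ j ∈ bits b', u ≤ j → j ∈ S := fun j hj hju => hWS (hZW (k6 j hj hju))
  have hyb := hmem b' y T (h7.trans k1) (bits_subset_union_of_mod_eq k5 h8 k7) k4 k3.le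
  obtain ⟨-, a', T', l1, l2, l3⟩ := hZW (k6 y hyb.1 k3.le)
  let u' := max (max T T') (max (y + 1) (max a' b'))
  have hpow : ∀ c ≤ u', c < 2 ^ u' := fun c hc =>
    Nat.lt_two_pow_self.trans_le (Nat.pow_le_pow_right two_pos hc)
  have hyu : y + 1 ≤ u' := le_max_of_le_right (le_max_left _ _)
  refine ⟨a', b', u', y, fun n n1 n2 n3 => ⟨⟨hpow _ (by simp [u']), hpow _ (by simp [u'])⟩,
    ⟨l1, k5⟩, fun j hj hja hju => mem_bits_restrict.2 ⟨hj.trans_le n2, l2 j hja hju⟩,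
    fun j hj hjb hju => mem_bits_restrict.2 ⟨hj.trans_le n3, k7 j hjb hju⟩,
    ⟨k3.le, hyu, mem_bits_restrict.2 ⟨hyu.trans n1, hyb.2⟩⟩,
    l3.mono (by simp [u']), k4.mono (by simp [u'])⟩⟩

/-- The result of the construction: an infinite set `Y` all of whose finite subsets are included
both in some `Φ_i^a` and in some `Φ_i^b`, where `a` and `b` disagree at `x`. -/
theorem exists_split_set {d : ℕ} {S : Set ℕ} {x i a b u : ℕ} (hS : S.Infinite)
    (hdu : ∀ j ∈ bits d, j < u)
    (hbdd : ∀ a Z u, Z ⊆ S → Z.Infinite → SetReducible Z S → a < 2 ^ u → (∀ z ∈ Z, u ≤ z) →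
      bits d ⊆ bits a → bits a ⊆ bits d ∪ S → ¬ ForcesBounded i a Z)
    (hsub : ∀ a Z u, Z ⊆ S → Z.Infinite → SetReducible Z S → a < 2 ^ u → (∀ z ∈ Z, u ≤ z) →
      bits d ⊆ bits a → bits a ⊆ bits d ∪ S → ¬ ForcesNotSubset i a Z)
    (h : Split d S x a b u) :
    ∃ Y ⊆ tail S u, Y.Infinite ∧ SetReducible Y S ∧ ∀ f, bits f ⊆ Y → ∃ a' b' u',
      Split d S x a' b' u' ∧
        ∀ j ∈ bits f, Conv i (bits a') j 1 u' ∧ Conv i (bits b') j 1 u' := by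
  let A : ℕ → ℕ := fun s => s.unpair.1.unpair.1
  let B : ℕ → ℕ := fun s => s.unpair.1.unpair.2
  let U : ℕ → ℕ := fun s => s.unpair.2.unpair.1
  let V : ℕ → ℕ := fun s => s.unpair.2.unpair.2
  have hQ : PrimrecPred fun q : ℕ × ℕ => SplitStep i q.2 (A q.1.unpair.1) (B q.1.unpair.1)
      (U q.1.unpair.1) (A q.1.unpair.2.unpair.1) (B q.1.unpair.2.unpair.1)
      (U q.1.unpair.2.unpair.1) (V q.1.unpair.2.unpair.1) := by
    simp only [A, B, U, V]
    refine primrecPred_splitStep ?_ ?_ ?_ ?_ ?_ ?_ ?_ ?_ <;> fun_prop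
  have hP := RecIn.reducible_of_primrecPred (A := S) RecIn.restrict
    (Q := fun n m => SplitStep i m (A n.unpair.1) (B n.unpair.1)
      (U n.unpair.1) (A n.unpair.2.unpair.1) (B n.unpair.2.unpair.1)
      (U n.unpair.2.unpair.1) (V n.unpair.2.unpair.1)) hQ
  obtain ⟨f, hf, hf0, hfP⟩ := RecIn.exists_seq hP
    (fun s => Split d S x (A s) (B s) (U s) ∧ u ≤ U s) (Nat.pair (Nat.pair a b) (Nat.pair u 0))
    (by simpa [A, B, U] using h)
    (by
      rintro s ⟨hs, hus⟩
      obtain ⟨a', b', u', y, h'⟩ := hs.exists_step hS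
        (fun j hj => (hdu j hj).trans_le hus) hbdd hsub
      -- No extra search witness is needed: the code of the new state already exceeds `a'`, `b'` and
      -- `u'`, so the segment of `S` used in the test is long enough.
      refine ⟨Nat.pair (Nat.pair (Nat.pair a' b') (Nat.pair u' y)) 0, ?_⟩
      simp only [Set.mem_ofPred_eq, Nat.unpair_pair, A, B, U, V]
      have l1 := Nat.left_le_pair a' b'
      have l2 := Nat.right_le_pair a' b'
      have l3 := Nat.left_le_pair u' y
      have l4 := Nat.left_le_pair (Nat.pair a' b') (Nat.pair u' y)
      have l5 := Nat.right_le_pair (Nat.pair a' b') (Nat.pair u' y)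
      have l6 := (Nat.left_le_pair (Nat.pair (Nat.pair a' b') (Nat.pair u' y)) 0).trans
        (Nat.right_le_pair s _)
      exact h' _ (by omega) (by omega) (by omega))
    (by
      rintro s n ⟨hs, hus⟩ hn
      simp only [Set.mem_ofPred_eq, Nat.unpair_pair] at hn
      refine ⟨hs.step hn, ?_⟩
      have := hn.2.2.2.2.1
      omega)
  simp only [Set.mem_ofPred_eq, Nat.unpair_pair] at hfP
  have hsplit : ∀ k, Split d S x (A (f k)) (B (f k)) (U (f k)) := fun k => (hfP k).1.1
  choose t ht using fun k => (hfP k).2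
  have hyu : ∀ k, U (f k) ≤ V (f (k + 1)) ∧ V (f (k + 1)) < U (f (k + 1)) ∧
      V (f (k + 1)) ∈ S := fun k => by
    obtain ⟨h1, h2, h3⟩ := (ht k).2.2.2.2.1
    exact ⟨h1, h2, (mem_bits_restrict.1 h3).2⟩
  have hU : Monotone fun k => U (f k) := monotone_nat_of_le_succ fun k => by
    have := hyu k
    omega
  have hmono : StrictMono fun k => V (f (k + 1)) := strictMono_nat_of_lt_succ fun k => by
    have h1 := hyu k
    have h2 := hyu (k + 1)
    omega
  have hagree : ∀ j k, j ≤ k → ∀ m < U (f j), (m ∈ bits (A (f k)) ↔ m ∈ bits (A (f j))) ∧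
      (m ∈ bits (B (f k)) ↔ m ∈ bits (B (f j))) := by
    intro j k hjk
    induction k, hjk using Nat.le_induction with
    | base => exact fun m _ => ⟨Iff.rfl, Iff.rfl⟩
    | succ k hjk ih =>
      intro m hm
      have hm' : m < U (f k) := hm.trans_le (hU hjk)
      obtain ⟨h1, h2⟩ := (ht k).2.1
      exact ⟨(mem_bits_of_mod_eq h1 hm').trans (ih m hm).1,
        (mem_bits_of_mod_eq h2 hm').trans (ih m hm).2⟩
  have hV : RecIn S fun k => V (f (k + 1)) := RecIn.of_primrec_comp (f := V)
    (by simp only [V]; fun_prop) (hf.comp (RecIn.of_primrec Primrec.succ))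
  refine ⟨Set.range fun k => V (f (k + 1)), ?_, Set.infinite_range_of_injective hmono.injective,
    RecIn.reducible_range hV hmono, fun c hc => ⟨_, _, _, hsplit c, fun j hj => ?_⟩⟩
  · rintro _ ⟨k, rfl⟩
    exact ⟨(hyu k).2.2, (hfP k).1.2.trans (hyu k).1⟩
  · obtain ⟨k, rfl⟩ := hc hj
    -- The `k`-th element of `Y` is at least `k`, and elements of the finite set are below its code
    -- `c`. Hence stage `c` has already enumerated all of them on both sides.
    have hk : k + 1 ≤ c := (hmono.le_apply (x := k)).trans_lt (lt_of_mem_bits hj)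
    obtain ⟨-, -, -, -, -, h1, h2⟩ := ht k
    exact ⟨(h1.congr fun m hm => (hagree _ _ hk m hm).1.symm).mono (hU hk),
      (h2.congr fun m hm => (hagree _ _ hk m hm).2.symm).mono (hU hk)⟩

/-- Every condition has an extension that bounds `Φ_i^G`, or forces that it is not a subset of `G`,
or forces a wrong or missing answer. -/
theorem exists_extension {I : Set (Set ℕ)} (hI : IsTuringIdeal I) (i : ℕ)
    (P : ℕ → ℕ → ℕ → ℕ → Prop) (p : Condition) (hp : p.S ∈ I) :
    ∃ q : Condition, Extends q p ∧ q.S ∈ I ∧ (((ForcesBounded i q.index q.S ∨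
      ForcesNotSubset i q.index q.S) ∨ ForcesError P i q.index q.S) ∨ ForcesUndefined P q.S) := by
  by_contra hcon
  push Not at hcon
  have hno : ∀ a Z u, Z ⊆ p.S → Z.Infinite → SetReducible Z p.S → a < 2 ^ u → (∀ z ∈ Z, u ≤ z) →
      bits p.index ⊆ bits a → bits a ⊆ bits p.index ∪ p.S → ((¬ ForcesBounded i a Z ∧
        ¬ ForcesNotSubset i a Z) ∧ ¬ ForcesError P i a Z) ∧ ¬ ForcesUndefined P Z := by
    intro a Z u h1 h2 h3 h4 h5 h6 h7
    let q : Condition := ⟨bitFinset a, Z, h2, fun j hj z hz =>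
      (lt_of_mem_bits_of_lt (mem_bitFinset.1 hj) h4).trans_le (h5 z hz)⟩
    have hq : q.index = a := sum_bitFinset a
    rw [p.bits_index] at h6 h7
    have := hcon q ⟨by simpa [q] using h6, by simpa [q] using h7, h1⟩
      (hI.mem_of_reducible _ _ hp h3)
    rwa [hq] at this
  obtain ⟨x, hx⟩ := p.infinite.nonempty
  have hdx : ∀ j ∈ bits p.index, j < x := fun j hj => by
    rw [p.bits_index] at hj
    exact p.lt j hj x hx
  obtain ⟨a, ha⟩ := exists_bits_eq ((finite_bits p.index).insert x)
  let u := max a (max p.index x) + 1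
  have hpow : ∀ c < u, c < 2 ^ u := fun c hc => hc.trans Nat.lt_two_pow_self
  have hau : a < 2 ^ u := hpow _ (Nat.lt_succ_of_le (by simp))
  have hxu : x < u := Nat.lt_succ_of_le (by simp)
  have hda : bits p.index ⊆ bits a := ha ▸ Set.subset_insert _ _
  have haS : bits a ⊆ bits p.index ∪ p.S :=
    ha ▸ Set.insert_subset (Or.inr hx) Set.subset_union_left
  have hsplit : Split p.index p.S x a p.index u := by
    refine ⟨⟨hau, hpow _ (Nat.lt_succ_of_le (by simp)), hxu⟩, ⟨hda, haS, ?_⟩, subset_rfl,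
      Set.subset_union_left, fun h => lt_irrefl _ (hdx x h)⟩
    rw [ha]
    exact Set.mem_insert _ _
  obtain ⟨Y, hYS, hYinf, hYred, hY⟩ := exists_split_set p.infinite
    (fun j hj => (hdx j hj).trans hxu)
    (fun a Z u h1 h2 h3 h4 h5 h6 h7 => (hno a Z u h1 h2 h3 h4 h5 h6 h7).1.1.1)
    (fun a Z u h1 h2 h3 h4 h5 h6 h7 => (hno a Z u h1 h2 h3 h4 h5 h6 h7).1.1.2) hsplit
  -- Any finite part would do here, as `ForcesUndefined` speaks only of the reservoir `Y`.
  have hdef := (hno a Y u (fun y hy => (hYS hy).1) hYinf hYred hau (fun y hy => (hYS hy).2)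
    hda haS).2
  unfold ForcesUndefined at hdef
  push Not at hdef
  obtain ⟨f, v, T, hf, hP⟩ := hdef x
  obtain ⟨a', b', u', ⟨⟨h1, h2, h3⟩, ⟨h4, h5, h6⟩, h7, h8, h9⟩, hconv⟩ := hY f hf
  -- Cutting the reservoir at `u'` preserves the computations from `c` and fixes membership of `x`,
  -- so a wrong answer would be a forced error.
  have herr : ∀ c, c < 2 ^ u' → bits p.index ⊆ bits c → bits c ⊆ bits p.index ∪ p.S →
      (∀ j ∈ bits f, Conv i (bits c) j 1 u') → v = charFn (bits c) x := by
    intro c k1 k2 k3 k4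
    by_contra hv
    exact (hno c (tail p.S u') u' (fun z hz => hz.1) (infinite_tail p.infinite _)
      (tail_reducible _ _) k1 (fun z hz => hz.2) k2 k3).1.2
      ⟨x, f, v, u', T, h3, k4, hP, hv, fun z hz => hz.2⟩
  have e1 := herr a' h1 h4 h5 fun j hj => (hconv j hj).1
  have e2 := herr b' h2 h7 h8 fun j hj => (hconv j hj).2
  rw [charFn_of_mem h6] at e1
  rw [charFn_of_notMem h9] at e2
  omega

end Density

/-! ### From genericity to the two claims. -/

section Main

theorem SetReducible.refl (A : Set ℕ) : SetReducible A A := setReducible_iff.2 RecIn.charFn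

theorem Satisfies.mem_iff {G : Set ℕ} {p : Condition} (h : Satisfies G p) {u : ℕ}
    (hu : ∀ s ∈ p.S, u ≤ s) : ∀ j < u, j ∈ bits p.index ↔ j ∈ G := by
  intro j hj
  rw [p.bits_index]
  exact ⟨fun hd => h.1 hd, fun hG => (h.2 hG).resolve_right fun hS =>
    absurd hj (not_lt.2 (hu j hS))⟩

theorem Satisfies.bits_restrict {G : Set ℕ} {p : Condition} (h : Satisfies G p) {N : ℕ}
    (hN : p.index ≤ N) : bits p.index ⊆ bits (restrict G N) ∧
      bits (restrict G N) ⊆ bits p.index ∪ p.S := by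
  refine ⟨fun j hj => mem_bits_restrict.2 ⟨(lt_of_mem_bits hj).trans_le hN, h.1 ?_⟩,
    fun j hj => ?_⟩
  · rwa [p.bits_index] at hj
  · rw [p.bits_index]
    exact h.2 (mem_bits_restrict.1 hj).2

/-- A generic set `G` has no infinite `G`-computable subset `X` such that `G` can be enumerated in a
uniform way from the finite subsets of every infinite `G`-computable subset of `X`. -/
theorem IsGeneric.not_uniformly_computable {I : Set (Set ℕ)} (hI : IsTuringIdeal I)
    {A₀ A₁ : Set ℕ} (hA : IsExactPair A₀ A₁ I) {G : Set ℕ} (hG : IsGeneric 3 I A₀ A₁ G) {X : Set ℕ}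
    (hXG : X ⊆ G) (hX : X.Infinite) (hXred : SetReducible X G) {P : ℕ → ℕ → ℕ → ℕ → Prop}
    (hP : PrimrecPred fun q : ℕ × ℕ × ℕ × ℕ => P q.1 q.2.1 q.2.2.1 q.2.2.2)
    (hsound : ∀ x f v T, bits f ⊆ X → P x f v T → v = charFn G x) :
    ¬ ∀ Y ⊆ X, Y.Infinite → SetReducible Y G → ∀ x, ∃ f v T, bits f ⊆ Y ∧ P x f v T := by
  intro hcomplete
  obtain ⟨i, hi⟩ := exists_computes hXred
  have hred : SetReducible A₀ (join A₀ A₁) := join_left_reducible _ _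
  have hdef := isDefinableCollection hA hred
    ((((isSigmaTwoProperty_forcesBounded A₀ i).or (isSigmaTwoProperty_forcesNotSubset A₀ i)).or
      (isSigmaTwoProperty_forcesError A₀ i hP)).or (isSigmaTwoProperty_forcesUndefined A₀ hP))
  rcases hG _ hdef with ⟨p, ⟨-, hp⟩, hGp⟩ | ⟨p, hpI, -, hp⟩
  · rcases hp with ((⟨n, h⟩ | ⟨y, u, h1, h2, h3, h4⟩) | ⟨x, f, v, u, T, h1, h2, h3, h4, h5⟩) | ⟨x, h⟩
    · obtain ⟨y, hy, hny⟩ := hX.exists_gt n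
      obtain ⟨T, hT⟩ := hi.conv y
      rw [charFn_of_mem hy] at hT
      obtain ⟨h1, h2⟩ := hGp.bits_restrict (le_max_right T p.index)
      exact h _ y T h1 h2 hny ((conv_bits_restrict (le_max_left _ _)).2 hT)
    · have hyX : y ∈ X := charFn_eq_one.1 (hi.eq_charFn (h1.congr (hGp.mem_iff h4))).symm
      exact h2 ((hGp.mem_iff h4 y h3).2 (hXG hyX))
    · have hfX : bits f ⊆ X := fun j hj =>
        charFn_eq_one.1 (hi.eq_charFn ((h2 j hj).congr (hGp.mem_iff h5))).symm
      exact h4 ((hsound _ _ _ _ hfX h3).trans (charFn_congr (hGp.mem_iff h5 x h1).symm))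
    -- Removing a finite part puts `X ⊆ G` inside the reservoir, so the tail of `X` is a
    -- `G`-computable set with no answer at `x`.
    · have hY : tail X p.index ⊆ p.S := fun y hy =>
        (hGp.2 (hXG hy.1)).resolve_left fun hyD => by
          rw [← p.bits_index] at hyD
          exact absurd (lt_of_mem_bits hyD) (not_lt.2 hy.2)
      obtain ⟨f, v, T, hf, hPf⟩ := hcomplete (tail X p.index) (fun y hy => hy.1)
        (infinite_tail hX _) ((tail_reducible _ _).trans hXred) x
      exact h f v T (hf.trans hY) hPf
  · obtain ⟨q, hqp, hqI, hq⟩ := exists_extension hI i P p hpI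
    exact hp q ⟨hqI, hq⟩ hqp

theorem IsGeneric.infinite {I : Set (Set ℕ)} (hI : IsTuringIdeal I) {A₀ A₁ : Set ℕ}
    (hA : IsExactPair A₀ A₁ I) {G : Set ℕ} (hG : IsGeneric 3 I A₀ A₁ G) : G.Infinite := by
  refine Set.infinite_of_forall_exists_gt fun n => ?_
  rcases hG _ (isDefinableCollection hA (join_left_reducible _ _)
    (isSigmaTwoProperty_exists_ge A₀ (n + 1))) with ⟨p, ⟨-, j, hj, hn⟩, hGp⟩ | ⟨p, hpI, -, hp⟩
  · rw [p.bits_index] at hj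
    exact ⟨j, hGp.1 hj, hn⟩
  · exfalso
    obtain ⟨s, hs, hns⟩ := p.infinite.exists_gt n
    let q : Condition := ⟨insert s p.D, tail p.S (s + 1), infinite_tail p.infinite _, by
      intro j hj z hz
      rcases Finset.mem_insert.1 hj with rfl | hj
      · exact hz.2
      · exact p.lt j hj z hz.1⟩
    refine hp q ⟨hI.mem_of_reducible _ _ hpI (tail_reducible _ _), s, ?_, hns⟩ ⟨?_, ?_, ?_⟩
    · rw [q.bits_index]
      simp [q]
    · simp [q]
    · simp only [q, Finset.coe_insert]
      exact Set.insert_subset (Or.inr hs) Set.subset_union_left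
    · exact fun z hz => hz.1

/-- Soundness on finite sets follows from the assumption on infinite ones: a finite `F ⊆ X` together
with the part of `X` at or above the use is infinite and gives the same computation. -/
theorem exists_subset_not_computes {I : Set (Set ℕ)} (hI : IsTuringIdeal I)
    {A₀ A₁ : Set ℕ} (hA : IsExactPair A₀ A₁ I) {G : Set ℕ} (hG : IsGeneric 3 I A₀ A₁ G) {X : Set ℕ}
    (hXG : X ⊆ G) (hX : X.Infinite) (hXred : SetReducible X G) (e : ℕ) :
    ∃ Y ⊆ X, Y.Infinite ∧ SetReducible Y G ∧ ¬ Computes e Y G := by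
  by_contra hcon
  push Not at hcon
  refine hG.not_uniformly_computable hI hA hXG hX hXred
    (P := fun x f v T => Conv e (bits f) x v T) (by fun_prop) ?_ ?_
  · intro x f v T hf h
    let Y : Set ℕ := {n | n ∈ bits f ∨ T ≤ n ∧ n ∈ X}
    have hY : Y ⊆ X := by
      rintro n (hn | hn)
      · exact hf hn
      · exact hn.2
    have hYinf : Y.Infinite := (infinite_tail hX T).mono fun n hn => Or.inr ⟨hn.2, hn.1⟩
    have hYred : SetReducible Y X :=
      reducible_of_primrecPred_mem (Q := fun n p => n ∈ bits f ∨ T ≤ n ∧ p) (by fun_prop)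
    refine (hcon Y hY hYinf (hYred.trans hXred)).eq_charFn (h.congr fun n hn => ?_)
    exact ⟨Or.inl, fun h => h.resolve_right fun h => absurd hn (not_lt.2 h.1)⟩
  · intro Y hYX hY hYred x
    obtain ⟨T, hT⟩ := (hcon Y hYX hY hYred).conv x
    exact ⟨restrict Y T, charFn G x, T, fun n hn => (mem_bits_restrict.1 hn).2,
      (conv_bits_restrict le_rfl).2 hT⟩

/-- This lets `D ∪ F` be coded by a sum, keeping the relation used for (1) visibly primitive
recursive. -/
theorem bits_add {a b : ℕ} (h : Disjoint (bits a) (bits b)) : bits (a + b) = bits a ∪ bits b := by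
  have hd : Disjoint (bitFinset a) (bitFinset b) := by
    rw [← Finset.disjoint_coe]
    simpa using h
  have : a + b = ∑ i ∈ bitFinset a ∪ bitFinset b, 2 ^ i := by
    rw [Finset.sum_union hd, sum_bitFinset, sum_bitFinset]
  rw [this, bits_sum_two_pow]
  simp

theorem reducible_inter {A B G : Set ℕ} (hA : SetReducible A G) (hB : SetReducible B G) :
    SetReducible (A ∩ B) G := by
  have := RecIn.reducible_of_primrecPred (A := G)
    ((setReducible_iff.1 hA).pair (setReducible_iff.1 hB))
    (Q := fun _ m => m.unpair.1 = 1 ∧ m.unpair.2 = 1) (by fun_prop)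
  simp only [Nat.unpair_pair, charFn_eq_one] at this
  exact this

theorem isTuringIdeal_principal (G : Set ℕ) : IsTuringIdeal (principal G) where
  nonempty := ⟨G, .refl G⟩
  mem_of_reducible _ _ hB h := h.trans hB
  join_mem A B hA hB := by
    have := RecIn.reducible_of_primrecPred (A := G)
      (((setReducible_iff.1 hA).pair (setReducible_iff.1 hB)).comp
        (RecIn.of_primrec (f := fun n => n / 2) (by fun_prop)))
      (Q := fun n m => (n % 2 = 0 ∧ m.unpair.1 = 1) ∨ (n % 2 = 1 ∧ m.unpair.2 = 1)) (by fun_prop)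
    simp only [Nat.unpair_pair, charFn_eq_one] at this
    refine (congrArg (SetReducible · G) (Set.ext fun n => ?_)).mp this
    constructor
    · rintro (⟨h, h'⟩ | ⟨h, h'⟩)
      · exact Or.inl ⟨_, h', by omega⟩
      · exact Or.inr ⟨_, h', by omega⟩
    · rintro (⟨x, h, rfl⟩ | ⟨x, h, rfl⟩)
      · exact Or.inl ⟨by omega, by rwa [show 2 * x / 2 = x by omega]⟩
      · exact Or.inr ⟨by omega, by rwa [show (2 * x + 1) / 2 = x by omega]⟩

theorem not_reducible_of_generic_subset {I : Set (Set ℕ)} (hI : IsTuringIdeal I)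
    {A₀ A₁ : Set ℕ} (hA : IsExactPair A₀ A₁ I) {G : Set ℕ} (hG : IsGeneric 3 I A₀ A₁ G)
    {B₀ B₁ : Set ℕ} (hB : IsExactPair B₀ B₁ (principal G)) {H : Set ℕ}
    (hH : IsGeneric 3 (principal G) B₀ B₁ H) (hHG : H ⊆ G) : ¬ SetReducible G H := by
  intro hGH
  obtain ⟨e, he⟩ := exists_computes hGH
  -- `ForcesWrong` consults `G`, which belongs to its own principal ideal and is thus computable
  -- from any exact pair presenting it.
  have hGJ : SetReducible G (join B₀ B₁) :=
    ((hB G).1 (SetReducible.refl G)).1.trans (join_left_reducible _ _)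
  rcases hH _ (isDefinableCollection hB hGJ ((isSigmaTwoProperty_forcesWrong G e).or
    (isSigmaTwoProperty_forcesDivergence G e))) with ⟨p, ⟨-, hp⟩, hHp⟩ | ⟨p, hpG, hHp, hp⟩
  · rcases hp with ⟨x, v, u, h1, h2, h3⟩ | ⟨x, h⟩
    · exact h2 (he.eq_charFn (h1.congr (hHp.mem_iff h3)))
    · obtain ⟨T, hT⟩ := he.conv x
      obtain ⟨h1, h2⟩ := hHp.bits_restrict (le_max_right T p.index)
      exact h _ _ T h1 h2 ((conv_bits_restrict (le_max_left _ _)).2 hT)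
  · have hpG : SetReducible p.S G := hpG
    have hHinf : H.Infinite := hH.infinite (isTuringIdeal_principal G) hB
    -- The generic `H` is infinite and, apart from `p.D`, lies in both `G` and the reservoir.
    have hXinf : (G ∩ p.S).Infinite := (hHinf.sdiff p.D.finite_toSet).mono fun n hn =>
      ⟨hHG hn.1, (hHp.2 hn.1).resolve_left hn.2⟩
    have hdisj : ∀ f, bits f ⊆ p.S → bits (f + p.index) = bits f ∪ p.D := fun f hf => by
      rw [bits_add, p.bits_index]
      rw [p.bits_index]
      exact Set.disjoint_left.2 fun n hn hnD => lt_irrefl _ (p.lt n hnD n (hf hn))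
    refine hG.not_uniformly_computable hI hA (X := G ∩ p.S) Set.inter_subset_left hXinf
      (reducible_inter (.refl G) hpG) (P := fun x f v T => Conv e (bits (f + p.index)) x v T)
      (by fun_prop) ?_ ?_
    · intro x f v T hf h
      by_contra hv
      have hf' : bits f ⊆ p.S := hf.trans Set.inter_subset_right
      let u := max T (f + p.index)
      -- A wrong answer from `D ∪ F` would make this extension of `p` force a wrong value, which `p`
      -- excludes.
      let q : Condition := ⟨bitFinset (f + p.index), tail p.S u, infinite_tail p.infinite _, by
        intro j hj z hz
        exact (lt_of_mem_bits (mem_bitFinset.1 hj)).trans_le ((le_max_right T _).trans hz.2)⟩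
      have hq : q.index = f + p.index := sum_bitFinset _
      refine hp q ⟨(tail_reducible _ _).trans hpG, Or.inl ⟨x, v, T, by rwa [hq], hv, fun s hs =>
        (le_max_left T _).trans hs.2⟩⟩ ⟨?_, ?_, fun z hz => hz.1⟩
      · simp only [q, coe_bitFinset, hdisj f hf']
        exact Set.subset_union_right
      · simp only [q, coe_bitFinset, hdisj f hf']
        exact Set.union_subset (hf'.trans Set.subset_union_right) Set.subset_union_left
    · intro Y hYX hY hYred x
      -- With reservoir `Y` the condition still extends `p`, hence cannot force divergence at `x`. A
      -- convergent computation uses some `a` between `D` and `D ∪ Y`, and `F = a ∩ Y` recovers it.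
      let q : Condition := ⟨p.D, Y, hY, fun j hj y hy => p.lt j hj y (hYX hy).2⟩
      have hq : ¬ ForcesDivergence e q.index Y := fun h => hp q ⟨hYred, Or.inr h⟩
        ⟨subset_rfl, Set.subset_union_left, fun y hy => (hYX hy).2⟩
      unfold ForcesDivergence at hq
      push Not at hq
      obtain ⟨a, v, T, h1, h2, h3⟩ := hq x
      rw [q.bits_index] at h1 h2
      obtain ⟨f, hf⟩ := exists_bits_eq ((finite_bits a).inter_of_left Y)
      refine ⟨f, v, T, hf ▸ Set.inter_subset_right, ?_⟩
      rw [hdisj f (hf ▸ fun n hn => (hYX hn.2).2), hf]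
      convert h3 using 1
      ext n
      exact ⟨fun h => h.elim And.left fun h => h1 h, fun h => (h2 h).symm.imp (fun h' => ⟨h, h'⟩) id⟩

end Main

end MathiasForcing

theorem mainTheorem1 (I : Set (Set ℕ)) (hI : IsTuringIdeal I) (A₀ A₁ : Set ℕ)
    (hA : IsExactPair A₀ A₁ I) (G : Set ℕ) (hG : IsGeneric 3 I A₀ A₁ G) :
    (∀ B₀ B₁ : Set ℕ, IsExactPair B₀ B₁ (principal G) →
      ∀ H : Set ℕ, IsGeneric 3 (principal G) B₀ B₁ H → H ⊆ G → ¬ SetReducible G H) ∧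
    (∀ X : Set ℕ, X ⊆ G → X.Infinite → SetReducible X G →
      ∀ e : ℕ, ∃ Y : Set ℕ, Y ⊆ X ∧ Y.Infinite ∧ SetReducible Y G ∧ ¬ Computes e Y G) :=
  ⟨fun _ _ hB _ hH hHG => not_reducible_of_generic_subset hI hA hG hB hH hHG,
    fun _ hXG hX hXred e => exists_subset_not_computes hI hA hG hXG hX hXred e⟩
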